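/- \textbf{Setting.} Let $\mathcal V$ be a uniformly discrete subset of the plane $\{x_3=0\}$ in $\mathbb R^3$ and $\mathcal E\subset\mathcal V\times\mathcal V$ a set of directed edges. For $e=(\alpha,\beta)\in\mathcal E$ put $l_e=|\beta-\alpha|$ and $\mathbf e_e=(\beta-\alpha)/l_e$, and assume $0<\inf_e l_e\le\sup_e l_e<\infty$. Assume that the number of edges starting at $\alpha$ plus the number of edges ending at $\alpha$ lies between $1$ and some $N$ independent of $\alpha$, for all $\alpha\in\mathcal V$. Let $U_e\in L^2([0,l_e],\mathbb R)$ with $\sup_e\|U_e\|_{L^2}<\infty$, $\mathbf A\in C^1(\mathbb R^3,\mathbb R^3)$, $k_R\in\mathbb R$, and $\epsilon:\mathcal V\to\mathbb R$ an arbitrary function. Set $a_e(t)=\langle \mathbf A(\alpha+t\mathbf e_e),\mathbf e_e\rangle$ and \[ \sigma_e=\begin{pmatrix}0&\mathbf e_{e,2}+i\mathbf e_{e,1}\\ \mathbf e_{e,2}-i\mathbf e_{e,1}&0\end{pmatrix},\qquad L_e=\Big(i\frac{d}{dt}+a_e+k_R\sigma_e\Big)^2+U_e-k_R^2,\qquad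 \nabla_e=\frac{d}{dt}-i(a_e+k_R\sigma_e). \] Let $\mathcal H=\bigoplus_{e\in\mathcal E}L^2([0,l_e],\mathbb C^2)$ (Hilbert direct sum). Let $\mathcal D$ be the set of all $f=(f_e)\in\mathcal H$ such that $f_e\in H^2([0,l_e],\mathbb C^2)$ for every $e$, $(L_ef_e)_e\in\mathcal H$, and $f$ is continuous at the nodes: for each $\alpha\in\mathcal V$ there is a vector $f(\alpha)\in\mathbb C^2$ with $f_e(0)=f(\alpha)$ for every edge $e$ starting at $\alpha$ and $f_e(l_e)=f(\alpha)$ for every edge $e$ ending at $\alpha$. Let $\Pi$ be the operator in $\mathcal H$ with domain $\mathcal D$ and $\Pi f=(L_ef_e)_e$. For $f\in\mathcal D$ put \[ f'(\alpha)=\sum_{e\text{ starting at }\alpha}(\nabla_ef_e)(0)-\sum_{e\text{ ending at }\alpha}(\nabla_ef_e)(l_e),\qquad \Gamma f=(f(\alpha))_{\alpha\in\mathcal V},\quad \Gamma'f=(f'(\alpha))_{\alpha\in\mathcal V}. \] Let $L$ be the restriction of $\Pi$ to those $f\in\mathcal D$ with $f'(\alpha)=\epsilon(\alpha)f(\alpha)$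 for all $\alpha\in\mathcal V$. \textbf{Proposition.} (1) The operator $\Pi$ is closed. (2) For every $f\in\mathcal D$ the families $\Gamma f$ and $\Gamma'f$ belong to $\ell^2(\mathcal V,\mathbb C^2)$. The map $(\Gamma,\Gamma'):\mathcal D\to\ell^2(\mathcal V,\mathbb C^2)\oplus\ell^2(\mathcal V,\mathbb C^2)$ is surjective with kernel dense in $\mathcal H$, and for all $f,g\in\mathcal D$ \[ \langle f,\Pi g\rangle-\langle\Pi f,g\rangle=\langle\Gamma f,\Gamma'g\rangle-\langle\Gamma'f,\Gamma g\rangle . \] Thus $(\ell^2(\mathcal V,\mathbb C^2),\Gamma,\Gamma')$ is a boundary triple for $\Pi$. (3) The spin-orbit Hamiltonian $L$ is (densely defined and) self-adjoint in $\mathcal H$. -/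

import Mathlib

open MeasureTheory Set
open scoped ENNReal

noncomputable section

/-- Three-dimensional Euclidean space. -/
abbrev R3 := EuclideanSpace ℝ (Fin 3)

/-- The spin space `ℂ²`. -/
abbrev Spin := EuclideanSpace ℂ (Fin 2)

/-- Lebesgue measure on the segment `[0,l]`. -/
abbrev segMeasure (l : ℝ) : Measure ℝ := volume.restrict (Icc 0 l)

/-- `L²([0,l],ℂ²)`. -/
abbrev SegL2 (l : ℝ) := Lp Spin 2 (segMeasure l)

/-! ### The Sobolev space `H²([0,l],ℂ²)` -/

/-- `f` is the `C¹` representative of `u ∈ L²([0,l],ℂ²)`, `f'` is its derivative on `[0,l]`, `f'` is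
absolutely continuous, and `f'' ∈ L²` is the (a.e. and weak) derivative of `f'`. -/
structure IsH2Rep (l : ℝ) (u : SegL2 l) (f f' f'' : ℝ → Spin) : Prop where
  ae_eq : u =ᵐ[segMeasure l] f
  memLp : MemLp f'' 2 (segMeasure l)
  deriv_eq : ∀ t ∈ Icc 0 l, f' t = f' 0 + ∫ s in (0 : ℝ)..t, f'' s
  eq : ∀ t ∈ Icc 0 l, f t = f 0 + ∫ s in (0 : ℝ)..t, f' s

/-- `u` belongs to `H²([0,l],ℂ²)`. -/
def IsH2 (l : ℝ) (u : SegL2 l) : Prop :=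
  ∃ p : (ℝ → Spin) × (ℝ → Spin) × (ℝ → Spin), IsH2Rep l u p.1 p.2.1 p.2.2

open Classical in
/-- The triple `(f, f', f'')` attached to `u ∈ H²([0,l],ℂ²)` (and zero if `u ∉ H²`). On `[0,l]`, `f` and
`f'` are uniquely determined by `u`, and `f''` is uniquely determined almost everywhere. -/
def h2Rep (l : ℝ) (u : SegL2 l) : (ℝ → Spin) × (ℝ → Spin) × (ℝ → Spin) :=
  if h : IsH2 l u then h.choose else 0

/-- The `C¹` representative of `u ∈ H²`. -/
def h2Val (l : ℝ) (u : SegL2 l) : ℝ → Spin := (h2Rep l u).1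

/-- The first derivative of `u ∈ H²`. -/
def h2D1 (l : ℝ) (u : SegL2 l) : ℝ → Spin := (h2Rep l u).2.1

/-- The second derivative of `u ∈ H²`. -/
def h2D2 (l : ℝ) (u : SegL2 l) : ℝ → Spin := (h2Rep l u).2.2

theorem IsH2.rep {l : ℝ} {u : SegL2 l} (h : IsH2 l u) :
    IsH2Rep l u (h2Val l u) (h2D1 l u) (h2D2 l u) := by
  have := h.choose_spec
  simpa only [h2Val, h2D1, h2D2, h2Rep, dif_pos h] using this

theorem IsH2Rep.isH2 {l : ℝ} {u : SegL2 l} {f f' f'' : ℝ → Spin} (h : IsH2Rep l u f f' f'') :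
    IsH2 l u := ⟨(f, f', f''), h⟩

theorem intervalIntegrable_of_seg {l t : ℝ} (ht : t ∈ Icc 0 l) {f : ℝ → Spin}
    (hf : IntegrableOn f (Icc 0 l)) : IntervalIntegrable f volume 0 t := by
  rw [intervalIntegrable_iff_integrableOn_Icc_of_le ht.1]
  exact hf.mono_set (Icc_subset_Icc_right ht.2)

theorem continuousOn_of_primitive {l : ℝ} {f g : ℝ → Spin} (hg : IntegrableOn g (Icc 0 l))
    (h : ∀ t ∈ Icc 0 l, f t = f 0 + ∫ s in (0 : ℝ)..t, g s) : ContinuousOn f (Icc 0 l) := by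
  rcases le_or_gt 0 l with hl | hl
  · have h2 := intervalIntegral.continuousOn_primitive_interval (μ := volume) (f := g) (a := 0) (b := l)
      (by rwa [uIcc_of_le hl])
    rw [uIcc_of_le hl] at h2
    exact (continuousOn_const.add h2).congr h
  · simp [Icc_eq_empty_of_lt hl]

theorem IsH2Rep.int2 {l : ℝ} {u : SegL2 l} {f f' f'' : ℝ → Spin} (h : IsH2Rep l u f f' f'') :
    IntegrableOn f'' (Icc 0 l) := h.memLp.integrable (by norm_num)

theorem IsH2Rep.cont1 {l : ℝ} {u : SegL2 l} {f f' f'' : ℝ → Spin} (h : IsH2Rep l u f f' f'') :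
    ContinuousOn f' (Icc 0 l) := continuousOn_of_primitive h.int2 h.deriv_eq

theorem IsH2Rep.int1 {l : ℝ} {u : SegL2 l} {f f' f'' : ℝ → Spin} (h : IsH2Rep l u f f' f'') :
    IntegrableOn f' (Icc 0 l) := h.cont1.integrableOn_Icc

theorem IsH2Rep.cont {l : ℝ} {u : SegL2 l} {f f' f'' : ℝ → Spin} (h : IsH2Rep l u f f' f'') :
    ContinuousOn f (Icc 0 l) := continuousOn_of_primitive h.int1 h.eq

theorem IsH2Rep.add {l : ℝ} {u v : SegL2 l} {f f' f'' g g' g'' : ℝ → Spin}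
    (h : IsH2Rep l u f f' f'') (k : IsH2Rep l v g g' g'') :
    IsH2Rep l (u + v) (f + g) (f' + g') (f'' + g'') where
  ae_eq := (Lp.coeFn_add u v).trans (h.ae_eq.add k.ae_eq)
  memLp := h.memLp.add k.memLp
  deriv_eq t ht := by
    simp only [Pi.add_apply]
    rw [intervalIntegral.integral_add (intervalIntegrable_of_seg ht h.int2)
      (intervalIntegrable_of_seg ht k.int2), h.deriv_eq t ht, k.deriv_eq t ht]
    abel
  eq t ht := by
    simp only [Pi.add_apply]
    rw [intervalIntegral.integral_add (intervalIntegrable_of_seg ht h.int1)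
      (intervalIntegrable_of_seg ht k.int1), h.eq t ht, k.eq t ht]
    abel

theorem IsH2Rep.smul {l : ℝ} {u : SegL2 l} {f f' f'' : ℝ → Spin} (c : ℂ)
    (h : IsH2Rep l u f f' f'') : IsH2Rep l (c • u) (c • f) (c • f') (c • f'') where
  ae_eq := (Lp.coeFn_smul c u).trans (h.ae_eq.const_smul c)
  memLp := h.memLp.const_smul c
  deriv_eq t ht := by
    simp only [Pi.smul_apply]
    rw [intervalIntegral.integral_smul, h.deriv_eq t ht, smul_add]
  eq t ht := by
    simp only [Pi.smul_apply]
    rw [intervalIntegral.integral_smul, h.eq t ht, smul_add]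

theorem IsH2Rep.zero (l : ℝ) : IsH2Rep l 0 0 0 0 where
  ae_eq := Lp.coeFn_zero _ _ _
  memLp := MemLp.zero
  deriv_eq t _ := by simp
  eq t _ := by simp

theorem ae_zero_of_primitive_zero {l : ℝ} (hl : 0 < l) {g : ℝ → Spin} (hg : IntegrableOn g (Icc 0 l))
    (h : ∀ t ∈ Icc 0 l, ∫ s in (0 : ℝ)..t, g s = 0) : g =ᵐ[segMeasure l] 0 := by
  have hi := intervalIntegrable_of_seg (right_mem_Icc.2 hl.le) hg
  have h1 := hi.ae_hasDerivAt_integral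
  rw [segMeasure, Measure.restrict_congr_set Ioo_ae_eq_Icc.symm]
  rw [Filter.EventuallyEq, ae_restrict_iff' measurableSet_Ioo]
  filter_upwards [h1] with x hx hxl
  have hx' := hx (by rw [uIcc_of_le hl.le]; exact Ioo_subset_Icc_self hxl) 0
    (by rw [uIcc_of_le hl.le]; exact left_mem_Icc.2 hl.le)
  have h0 : HasDerivAt (fun y => ∫ s in (0 : ℝ)..y, g s) 0 x := by
    refine (hasDerivAt_const x (0 : Spin)).congr_of_eventuallyEq ?_
    filter_upwards [Ioo_mem_nhds hxl.1 hxl.2] with y hy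
    exact h y (Ioo_subset_Icc_self hy)
  exact hx'.unique h0

theorem eq_zero_of_ae {l : ℝ} (hl : 0 < l) {f : ℝ → Spin} (hf : ContinuousOn f (Icc 0 l))
    (h : f =ᵐ[segMeasure l] 0) : ∀ t ∈ Icc 0 l, f t = 0 :=
  Measure.eqOn_Icc_of_ae_eq volume hl.ne h hf continuousOn_const

theorem IsH2Rep.eq_zero {l : ℝ} (hl : 0 < l) {f f' f'' : ℝ → Spin} (h : IsH2Rep l 0 f f' f'') :
    (∀ t ∈ Icc 0 l, f t = 0) ∧ (∀ t ∈ Icc 0 l, f' t = 0) ∧ f'' =ᵐ[segMeasure l] 0 := by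
  have h0 : (0 : ℝ) ∈ Icc 0 l := left_mem_Icc.2 hl.le
  have hf := eq_zero_of_ae hl h.cont (h.ae_eq.symm.trans (Lp.coeFn_zero _ _ _))
  have hf' := eq_zero_of_ae hl h.cont1 (ae_zero_of_primitive_zero hl h.int1 fun t ht => by
    simpa [hf t ht, hf 0 h0] using (h.eq t ht).symm)
  exact ⟨hf, hf', ae_zero_of_primitive_zero hl h.int2 fun t ht => by
    simpa [hf' t ht, hf' 0 h0] using (h.deriv_eq t ht).symm⟩

/-- The representative and its derivatives are determined by the element of `L²`. -/
theorem IsH2Rep.unique {l : ℝ} (hl : 0 < l) {u : SegL2 l} {f f' f'' g g' g'' : ℝ → Spin}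
    (h : IsH2Rep l u f f' f'') (k : IsH2Rep l u g g' g'') :
    (∀ t ∈ Icc 0 l, f t = g t) ∧ (∀ t ∈ Icc 0 l, f' t = g' t) ∧ f'' =ᵐ[segMeasure l] g'' := by
  have hk := h.add (k.smul (-1))
  rw [neg_one_smul, add_neg_cancel] at hk
  obtain ⟨h1, h2, h3⟩ := hk.eq_zero hl
  refine ⟨fun t ht => ?_, fun t ht => ?_, ?_⟩
  · have := h1 t ht
    simp only [neg_smul, one_smul, Pi.add_apply, Pi.neg_apply] at this
    exact add_neg_eq_zero.1 this
  · have := h2 t ht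
    simp only [neg_smul, one_smul, Pi.add_apply, Pi.neg_apply] at this
    exact add_neg_eq_zero.1 this
  · filter_upwards [h3] with t this
    simp only [neg_smul, one_smul, Pi.add_apply, Pi.neg_apply, Pi.zero_apply] at this
    exact add_neg_eq_zero.1 this

/-! ### The network -/

/-- A quantum network in the plane with magnetic field and Rashba spin-orbit interaction: the data
and the standing assumptions. -/
structure RashbaNetwork where
  /-- The nodes. -/
  vert : Set R3
  vert_plane : ∀ v ∈ vert, v 2 = 0
  vert_discrete : ∃ d : ℝ, 0 < d ∧ ∀ v ∈ vert, ∀ w ∈ vert, v ≠ w → d ≤ dist v w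
  /-- The directed edges. -/
  edge : Set (R3 × R3)
  edge_subset : edge ⊆ vert ×ˢ vert
  /-- The degrees (indegree plus outdegree) are positive and bounded. -/
  degree_bound : ∃ N : ℕ, ∀ v ∈ vert,
    1 ≤ {w | (w, v) ∈ edge}.encard + {w | (v, w) ∈ edge}.encard ∧
      {w | (w, v) ∈ edge}.encard + {w | (v, w) ∈ edge}.encard ≤ (N : ℕ∞)
  /-- The edge lengths are bounded away from zero and bounded. -/
  length_lower : ∃ c : ℝ, 0 < c ∧ ∀ e ∈ edge, c ≤ dist e.1 e.2
  length_upper : ∃ C : ℝ, ∀ e ∈ edge, dist e.1 e.2 ≤ C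
  /-- The scalar potentials on the edges. -/
  U : edge → ℝ → ℝ
  U_memLp : ∀ e : edge, MemLp (U e) 2 (segMeasure (dist e.1.1 e.1.2))
  U_bound : ∃ C : NNReal, ∀ e : edge, eLpNorm (U e) 2 (segMeasure (dist e.1.1 e.1.2)) ≤ C
  /-- The magnetic vector potential. -/
  A : R3 → R3
  A_contDiff : ContDiff ℝ 1 A
  /-- The Rashba constant. -/
  kR : ℝ
  /-- The coupling constants at the nodes. -/
  eps : vert → ℝ

namespace RashbaNetwork

variable (N : RashbaNetwork)

/-- The initial vertex of an edge. -/
def src (e : N.edge) : N.vert := ⟨e.1.1, (N.edge_subset e.2).1⟩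

/-- The terminal vertex of an edge. -/
def tgt (e : N.edge) : N.vert := ⟨e.1.2, (N.edge_subset e.2).2⟩

/-- The length of an edge. -/
abbrev len (e : N.edge) : ℝ := dist e.1.1 e.1.2

theorem len_pos (e : N.edge) : 0 < N.len e := by
  obtain ⟨c, hc, h⟩ := N.length_lower
  exact hc.trans_le (h e.1 e.2)

/-- The unit vector along an edge. -/
def dir (e : N.edge) : R3 := (N.len e)⁻¹ • (e.1.2 - e.1.1)

/-- The magnetic potential on an edge: the component of the vector potential along it. -/
def a (e : N.edge) (t : ℝ) : ℝ := inner ℝ (N.A (e.1.1 + t • N.dir e)) (N.dir e)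

/-- The spin matrix of an edge, as a linear map in `ℂ²`. -/
def spinMat (e : N.edge) : Spin →ₗ[ℂ] Spin :=
  Matrix.toEuclideanLin
    !![0, ((N.dir e 1 : ℝ) : ℂ) + Complex.I * ((N.dir e 0 : ℝ) : ℂ);
      ((N.dir e 1 : ℝ) : ℂ) - Complex.I * ((N.dir e 0 : ℝ) : ℂ), 0]

/-- `(i d/dt + a + k_R σ) f`, given `f` and its derivative `f'`. -/
def momentum (e : N.edge) (f f' : ℝ → Spin) (t : ℝ) : Spin :=
  Complex.I • f' t + (N.a e t : ℂ) • f t + (N.kR : ℂ) • N.spinMat e (f t)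

/-- The derivative of `momentum e f f'`, given also the second derivative `f''`. -/
def momentumDeriv (e : N.edge) (f f' f'' : ℝ → Spin) (t : ℝ) : Spin :=
  Complex.I • f'' t + (((deriv (N.a e) t : ℝ) : ℂ) • f t + (N.a e t : ℂ) • f' t)
    + (N.kR : ℂ) • N.spinMat e (f' t)

/-- The differential expression `(i d/dt + a + k_R σ)² f + U f - k_R² f` on an edge. -/
def edgeExpr (e : N.edge) (f f' f'' : ℝ → Spin) (t : ℝ) : Spin :=
  N.momentum e (N.momentum e f f') (N.momentumDeriv e f f' f'') t
    + (N.U e t : ℂ) • f t - ((N.kR : ℂ) ^ 2) • f t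

/-- `[d/dt - i (a + k_R σ)] f`, given `f` and its derivative `f'`. -/
def covDeriv (e : N.edge) (f f' : ℝ → Spin) (t : ℝ) : Spin :=
  f' t - Complex.I • ((N.a e t : ℂ) • f t + (N.kR : ℂ) • N.spinMat e (f t))

/-- The state space: the Hilbert direct sum over all edges of `L²([0,l_e],ℂ²)`. -/
abbrev StateSpace := lp (fun e : N.edge => SegL2 (N.len e)) 2

/-- The space `ℓ²(V,ℂ²)`. -/
abbrev NodeSpace := lp (fun _ : N.vert => Spin) 2

/-- The expression `L_e f_e` for an `H²` component `f_e`. -/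
def edgeOp (f : N.StateSpace) (e : N.edge) : ℝ → Spin :=
  N.edgeExpr e (h2Val _ (f e)) (h2D1 _ (f e)) (h2D2 _ (f e))

/-- `φ` gives the node values of `f`: at each node, all edge components have the value prescribed
by `φ`. Such a `φ` exists if and only if `f` is continuous at all nodes. -/
def IsNodeValues (f : N.StateSpace) (φ : N.vert → Spin) : Prop :=
  ∀ e, h2Val _ (f e) 0 = φ (N.src e) ∧ h2Val _ (f e) (N.len e) = φ (N.tgt e)

/-- The domain of the maximal operator: all components are in `H²`, the function obtained by
applying the differential expressions edgewise is in the state space, and `f` is continuous at all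
nodes. -/
structure MemDomain (f : N.StateSpace) : Prop where
  isH2 : ∀ e, IsH2 _ (f e)
  image : ∃ g : N.StateSpace, ∀ e, g e =ᵐ[segMeasure (N.len e)] N.edgeOp f e
  continuous : ∃ φ, N.IsNodeValues f φ

variable {N}

theorem val_add {l : ℝ} (hl : 0 < l) {u v : SegL2 l} (hu : IsH2 l u) (hv : IsH2 l v) :
    (∀ t ∈ Icc 0 l, h2Val l (u + v) t = h2Val l u t + h2Val l v t) ∧
    (∀ t ∈ Icc 0 l, h2D1 l (u + v) t = h2D1 l u t + h2D1 l v t) ∧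
    h2D2 l (u + v) =ᵐ[segMeasure l] h2D2 l u + h2D2 l v :=
  ((hu.rep.add hv.rep).isH2.rep).unique hl (hu.rep.add hv.rep)

theorem val_smul {l : ℝ} (hl : 0 < l) {u : SegL2 l} (c : ℂ) (hu : IsH2 l u) :
    (∀ t ∈ Icc 0 l, h2Val l (c • u) t = c • h2Val l u t) ∧
    (∀ t ∈ Icc 0 l, h2D1 l (c • u) t = c • h2D1 l u t) ∧
    h2D2 l (c • u) =ᵐ[segMeasure l] c • h2D2 l u :=
  ((hu.rep.smul c).isH2.rep).unique hl (hu.rep.smul c)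

theorem edgeOp_add {f g : N.StateSpace} (e : N.edge) (hf : IsH2 _ (f e)) (hg : IsH2 _ (g e)) :
    N.edgeOp (f + g) e =ᵐ[segMeasure (N.len e)] N.edgeOp f e + N.edgeOp g e := by
  obtain ⟨h1, h2, h3⟩ := val_add (N.len_pos e) hf hg
  filter_upwards [h3, ae_restrict_mem measurableSet_Icc] with t ht hI
  simp only [edgeOp, edgeExpr, momentum, momentumDeriv, lp.coeFn_add, Pi.add_apply, h1 t hI,
    h2 t hI, ht, smul_add, map_add]
  abel

theorem edgeOp_smul {f : N.StateSpace} (c : ℂ) (e : N.edge) (hf : IsH2 _ (f e)) :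
    N.edgeOp (c • f) e =ᵐ[segMeasure (N.len e)] c • N.edgeOp f e := by
  obtain ⟨h1, h2, h3⟩ := val_smul (N.len_pos e) c hf
  filter_upwards [h3, ae_restrict_mem measurableSet_Icc] with t ht hI
  simp only [edgeOp, edgeExpr, momentum, momentumDeriv, lp.coeFn_smul, Pi.smul_apply, h1 t hI,
    h2 t hI, ht, smul_add, map_add, map_smul, smul_sub, smul_comm _ c]

theorem IsNodeValues.add {f g : N.StateSpace} {φ ψ : N.vert → Spin}
    (hf : ∀ e, IsH2 _ (f e)) (hg : ∀ e, IsH2 _ (g e))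
    (h : N.IsNodeValues f φ) (k : N.IsNodeValues g ψ) : N.IsNodeValues (f + g) (φ + ψ) := by
  intro e
  obtain ⟨h1, -, -⟩ := val_add (N.len_pos e) (hf e) (hg e)
  have hl := (N.len_pos e).le
  simp only [lp.coeFn_add, Pi.add_apply]
  rw [h1 _ (left_mem_Icc.2 hl), h1 _ (right_mem_Icc.2 hl), (h e).1, (h e).2, (k e).1, (k e).2]
  exact ⟨rfl, rfl⟩

theorem IsNodeValues.smul {f : N.StateSpace} {φ : N.vert → Spin} (c : ℂ)
    (hf : ∀ e, IsH2 _ (f e)) (h : N.IsNodeValues f φ) : N.IsNodeValues (c • f) (c • φ) := by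
  intro e
  obtain ⟨h1, -, -⟩ := val_smul (N.len_pos e) c (hf e)
  have hl := (N.len_pos e).le
  simp only [lp.coeFn_smul, Pi.smul_apply]
  rw [h1 _ (left_mem_Icc.2 hl), h1 _ (right_mem_Icc.2 hl), (h e).1, (h e).2]
  exact ⟨rfl, rfl⟩

/-- Node values are unique because every node has an edge. -/
theorem IsNodeValues.unique {f : N.StateSpace} {φ ψ : N.vert → Spin}
    (h : N.IsNodeValues f φ) (k : N.IsNodeValues f ψ) : φ = ψ := by
  funext v
  obtain ⟨M, hM⟩ := N.degree_bound
  have h1 := (hM v v.2).1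
  by_cases hin : {w | (w, v.1) ∈ N.edge} = ∅
  · have hout : {w | (v.1, w) ∈ N.edge}.encard ≠ 0 := by
      intro h0
      rw [hin, h0] at h1
      simp at h1
    obtain ⟨w, hw⟩ := Set.encard_ne_zero.1 hout
    exact ((h ⟨(v.1, w), hw⟩).1).symm.trans ((k ⟨(v.1, w), hw⟩).1)
  · obtain ⟨w, hw⟩ := Set.nonempty_iff_ne_empty.2 hin
    exact ((h ⟨(w, v.1), hw⟩).2).symm.trans ((k ⟨(w, v.1), hw⟩).2)

theorem MemDomain.add {f g : N.StateSpace} (hf : N.MemDomain f) (hg : N.MemDomain g) :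
    N.MemDomain (f + g) where
  isH2 e := ((hf.isH2 e).rep.add (hg.isH2 e).rep).isH2
  image := by
    obtain ⟨p, hp⟩ := hf.image
    obtain ⟨q, hq⟩ := hg.image
    exact ⟨p + q, fun e => ((Lp.coeFn_add _ _).trans ((hp e).add (hq e))).trans
      (edgeOp_add e (hf.isH2 e) (hg.isH2 e)).symm⟩
  continuous := by
    obtain ⟨φ, hφ⟩ := hf.continuous
    obtain ⟨ψ, hψ⟩ := hg.continuous
    exact ⟨φ + ψ, hφ.add hf.isH2 hg.isH2 hψ⟩

theorem MemDomain.smul {f : N.StateSpace} (c : ℂ) (hf : N.MemDomain f) : N.MemDomain (c • f) where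
  isH2 e := ((hf.isH2 e).rep.smul c).isH2
  image := by
    obtain ⟨p, hp⟩ := hf.image
    exact ⟨c • p, fun e => ((Lp.coeFn_smul _ _).trans ((hp e).const_smul c)).trans
      (edgeOp_smul c e (hf.isH2 e)).symm⟩
  continuous := by
    obtain ⟨φ, hφ⟩ := hf.continuous
    exact ⟨c • φ, hφ.smul c hf.isH2⟩

theorem edgeOp_zero (e : N.edge) : N.edgeOp 0 e =ᵐ[segMeasure (N.len e)] 0 := by
  have := edgeOp_smul (f := (0 : N.StateSpace)) 0 e (IsH2Rep.zero _).isH2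
  simpa using this

theorem MemDomain.zero : N.MemDomain 0 where
  isH2 _ := (IsH2Rep.zero _).isH2
  image := ⟨0, fun e => (Lp.coeFn_zero _ _ _).trans (edgeOp_zero e).symm⟩
  continuous := ⟨0, fun e => by
    have h := ((IsH2Rep.zero (N.len e)).isH2.rep.unique (N.len_pos e) (IsH2Rep.zero _)).1
    exact ⟨h _ (left_mem_Icc.2 (N.len_pos e).le), h _ (right_mem_Icc.2 (N.len_pos e).le)⟩⟩

theorem state_ext {f g : N.StateSpace} {F : N.edge → ℝ → Spin}
    (hf : ∀ e, f e =ᵐ[segMeasure (N.len e)] F e) (hg : ∀ e, g e =ᵐ[segMeasure (N.len e)] F e) :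
    f = g := by
  ext1
  funext e
  exact Lp.ext ((hf e).trans (hg e).symm)

variable (N)

/-- The domain `𝒟` as a subspace of the state space. -/
def dom : Submodule ℂ N.StateSpace where
  carrier := {f | N.MemDomain f}
  add_mem' := MemDomain.add
  zero_mem' := MemDomain.zero
  smul_mem' c _ := MemDomain.smul c

/-- The maximal operator `Π`: it acts on each edge by the differential expression. -/
def maxOp : N.StateSpace →ₗ.[ℂ] N.StateSpace where
  domain := N.dom
  toFun :=
    { toFun := fun f => f.2.image.choose
      map_add' := fun f g => state_ext (f.2.add g.2).image.choose_spec fun e =>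
        ((Lp.coeFn_add _ _).trans ((f.2.image.choose_spec e).add (g.2.image.choose_spec e))).trans
          (edgeOp_add e (f.2.isH2 e) (g.2.isH2 e)).symm
      map_smul' := fun c f => state_ext (f.2.smul c).image.choose_spec fun e =>
        ((Lp.coeFn_smul _ _).trans ((f.2.image.choose_spec e).const_smul c)).trans
          (edgeOp_smul c e (f.2.isH2 e)).symm }

theorem maxOp_spec (f : N.maxOp.domain) (e : N.edge) :
    (N.maxOp f) e =ᵐ[segMeasure (N.len e)] N.edgeOp f e := f.2.image.choose_spec e

/-- The node values `f(α)` of `f ∈ 𝒟`. -/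
def nodeVal : N.dom →ₗ[ℂ] (N.vert → Spin) where
  toFun f := f.2.continuous.choose
  map_add' f g := IsNodeValues.unique (f.2.add g.2).continuous.choose_spec
    (f.2.continuous.choose_spec.add f.2.isH2 g.2.isH2 g.2.continuous.choose_spec)
  map_smul' c f := IsNodeValues.unique (f.2.smul c).continuous.choose_spec
    (f.2.continuous.choose_spec.smul c f.2.isH2)

theorem nodeVal_spec (f : N.dom) : N.IsNodeValues f (N.nodeVal f) := f.2.continuous.choose_spec

variable {N}

theorem finite_src (v : N.vert) : {e : N.edge | N.src e = v}.Finite := by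
  obtain ⟨M, hM⟩ := N.degree_bound
  have h1 : {w | (v.1, w) ∈ N.edge}.Finite :=
    Set.finite_of_encard_le_coe (le_add_self.trans (hM v v.2).2)
  refine Set.Finite.of_finite_image (f := fun e : N.edge => e.1.2) (h1.subset ?_) ?_
  · rintro _ ⟨e, rfl, rfl⟩
    exact e.2
  · intro e he e' he' h
    exact Subtype.ext (Prod.ext (congrArg Subtype.val (he.trans he'.symm)) h)

theorem finite_tgt (v : N.vert) : {e : N.edge | N.tgt e = v}.Finite := by
  obtain ⟨M, hM⟩ := N.degree_bound
  have h1 : {w | (w, v.1) ∈ N.edge}.Finite :=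
    Set.finite_of_encard_le_coe (le_self_add.trans (hM v v.2).2)
  refine Set.Finite.of_finite_image (f := fun e : N.edge => e.1.1) (h1.subset ?_) ?_
  · rintro _ ⟨e, rfl, rfl⟩
    exact e.2
  · intro e he e' he' h
    exact Subtype.ext (Prod.ext h (congrArg Subtype.val (he.trans he'.symm)))

variable (N)

/-- The covariant derivative `[d/dt - i (a + k_R σ)] f_e (t)` of an edge component. -/
def edgeCov (f : N.StateSpace) (e : N.edge) : ℝ → Spin :=
  N.covDeriv e (h2Val _ (f e)) (h2D1 _ (f e))

variable {N}

theorem edgeCov_add {f g : N.StateSpace} (e : N.edge) (hf : IsH2 _ (f e)) (hg : IsH2 _ (g e)) :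
    ∀ t ∈ Icc 0 (N.len e), N.edgeCov (f + g) e t = N.edgeCov f e t + N.edgeCov g e t := by
  intro t hI
  obtain ⟨h1, h2, -⟩ := val_add (N.len_pos e) hf hg
  simp only [edgeCov, covDeriv, lp.coeFn_add, Pi.add_apply, h1 t hI, h2 t hI, smul_add, map_add]
  abel

theorem edgeCov_smul {f : N.StateSpace} (c : ℂ) (e : N.edge) (hf : IsH2 _ (f e)) :
    ∀ t ∈ Icc 0 (N.len e), N.edgeCov (c • f) e t = c • N.edgeCov f e t := by
  intro t hI
  obtain ⟨h1, h2, -⟩ := val_smul (N.len_pos e) c hf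
  simp only [edgeCov, covDeriv, lp.coeFn_smul, Pi.smul_apply, h1 t hI, h2 t hI, smul_add, map_smul,
    smul_sub, smul_comm _ c]

variable (N)

/-- The node derivatives `f'(α)` of `f ∈ 𝒟`: the sum of the covariant derivatives at the node over
the outgoing edges minus the sum over the incoming edges. Both sums are finite. -/
def nodeDeriv : N.dom →ₗ[ℂ] (N.vert → Spin) where
  toFun f v := (∑ᶠ e ∈ {e : N.edge | N.src e = v}, N.edgeCov f e 0)
    - ∑ᶠ e ∈ {e : N.edge | N.tgt e = v}, N.edgeCov f e (N.len e)
  map_add' f g := by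
    funext v
    simp only [Submodule.coe_add, Pi.add_apply]
    rw [finsum_mem_congr rfl fun e _ => edgeCov_add e (f.2.isH2 e) (g.2.isH2 e) 0
        (left_mem_Icc.2 (N.len_pos e).le),
      finsum_mem_congr rfl fun e _ => edgeCov_add e (f.2.isH2 e) (g.2.isH2 e) (N.len e)
        (right_mem_Icc.2 (N.len_pos e).le),
      finsum_mem_add_distrib (finite_src v), finsum_mem_add_distrib (finite_tgt v)]
    abel
  map_smul' c f := by
    funext v
    simp only [Submodule.coe_smul, Pi.smul_apply, RingHom.id_apply]
    rw [finsum_mem_congr rfl fun e _ => edgeCov_smul c e (f.2.isH2 e) 0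
        (left_mem_Icc.2 (N.len_pos e).le),
      finsum_mem_congr rfl fun e _ => edgeCov_smul c e (f.2.isH2 e) (N.len e)
        (right_mem_Icc.2 (N.len_pos e).le),
      smul_sub, smul_finsum_mem (finite_src v), smul_finsum_mem (finite_tgt v)]

/-- The functions in `𝒟` satisfying the vertex conditions `f'(α) = ε(α) f(α)` at all nodes. -/
def hamiltonianDom : Submodule ℂ N.StateSpace :=
  Submodule.map N.dom.subtype
    { carrier := {f | ∀ v, N.nodeDeriv f v = (N.eps v : ℂ) • N.nodeVal f v}
      add_mem' := fun {f g} hf hg v => by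
        simp only [map_add, Pi.add_apply, hf v, hg v, smul_add]
      zero_mem' := fun v => by simp
      smul_mem' := fun c f hf v => by
        simp only [map_smul, Pi.smul_apply, hf v, smul_comm c] }

/-- The magnetic Rashba (spin-orbit) Hamiltonian: the restriction of the maximal operator to the
functions satisfying the vertex conditions. -/
def hamiltonian : N.StateSpace →ₗ.[ℂ] N.StateSpace := N.maxOp.domRestrict N.hamiltonianDom

end RashbaNetwork

/-- `(G, Γ, Γ')` is a boundary triple for the operator `T`: `T` is closed, the abstract Green identity
holds, `(Γ, Γ')` maps the domain of `T` onto `G ⊕ G`, and its kernel is dense. -/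
structure IsBoundaryTriple {H G : Type*} [NormedAddCommGroup H] [InnerProductSpace ℂ H]
    [NormedAddCommGroup G] [InnerProductSpace ℂ G] (T : H →ₗ.[ℂ] H)
    (Γ Γ' : T.domain →ₗ[ℂ] G) : Prop where
  closed : T.IsClosed
  green : ∀ f g : T.domain, inner ℂ (f : H) (T g) - inner ℂ (T f) (g : H)
    = inner ℂ (Γ f) (Γ' g) - inner ℂ (Γ' f) (Γ g)
  surjective : Function.Surjective fun f : T.domain => (Γ f, Γ' f)
  dense_ker : Dense {x : H | ∃ f : T.domain, (f : H) = x ∧ Γ f = 0 ∧ Γ' f = 0}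

end

/-! On one edge the matrix σ_e is constant and Hermitian, so the potential a_e + k_R σ_e is removed
by a unitary gauge: ∇_e turns into d/dt and L_e into -d²/dt² + (U_e - k_R²) (`covDeriv_gauge`,
`edgeExpr_gauge`). In this gauge two facts are elementary. Weak solutions tested against functions
with vanishing boundary data are in H² (`exists_primitive_of_weak`, `isEdgePair_of_weak`). Arbitrary
values and derivatives at the two ends extend to the edge by a cubic polynomial, with norms
controlled only by the bounds on the lengths, on U and on k_R (`exists_extension`). Green's formula
against such an extension bounds the boundary data by the graph norm, again uniformly in the edge
(`exists_trace_bound`).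

Bounded degrees carry these estimates from edges to nodes. The trace bound puts Γf and Γ'f in ℓ²,
the extension gives surjectivity of (Γ, Γ'), and the sum of the edge Green formulas, regrouped by
nodes, is the abstract Green identity (`green_maxOp`).

The core is `exists_maxOp_of_weak`: the weak equation tested against ker(Γ, Γ') already forces g ∈ 𝒟
and Πg = k. Regularity is obtained edge by edge; continuity at a node comes from test functions
whose derivative contributions at two edge ends cancel. Hence the graph of Π is an intersection of
closed sets, and a vector orthogonal to the kernel is Π0 = 0. Finally the adjoint of the Hamiltonian
is a restriction of Π, and testing at one node at a time shows that its elements satisfy the vertex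
conditions, since ε is real. -/

noncomputable section

/-! ### Absolutely continuous functions and the product rule -/

section Primitive

variable {E F G : Type*} [NormedAddCommGroup E] [NormedSpace ℝ E]
  [NormedAddCommGroup F] [NormedSpace ℝ F]
  [NormedAddCommGroup G] [NormedSpace ℝ G]

/-- `f` is absolutely continuous on `[0,l]` with integrable derivative `f'`. -/
structure IsPrimitive (l : ℝ) (f f' : ℝ → E) : Prop where
  int : IntegrableOn f' (Icc 0 l)
  eq : ∀ t ∈ Icc 0 l, f t = f 0 + ∫ s in (0 : ℝ)..t, f' s

theorem intervalIntegrable_of_Icc {E : Type*} [NormedAddCommGroup E] {l t : ℝ} (ht : t ∈ Icc 0 l)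
    {f : ℝ → E}
    (hf : IntegrableOn f (Icc 0 l)) : IntervalIntegrable f volume 0 t := by
  rw [intervalIntegrable_iff_integrableOn_Icc_of_le ht.1]
  exact hf.mono_set (Icc_subset_Icc_right ht.2)

theorem IsPrimitive.continuousOn {l : ℝ} {f f' : ℝ → E} (h : IsPrimitive l f f') :
    ContinuousOn f (Icc 0 l) := by
  rcases le_or_gt 0 l with hl | hl
  · have h2 := intervalIntegral.continuousOn_primitive_interval (μ := volume) (f := f') (a := 0)
      (b := l) (by rw [uIcc_of_le hl]; exact h.int)
    rw [uIcc_of_le hl] at h2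
    exact (continuousOn_const.add h2).congr h.eq
  · simp [Icc_eq_empty_of_lt hl]

theorem IsPrimitive.of_hasDerivAt [CompleteSpace E] {f f' : ℝ → E} (h : ∀ t, HasDerivAt f (f' t) t)
    (hf' : Continuous f') (l : ℝ) : IsPrimitive l f f' where
  int := hf'.continuousOn.integrableOn_Icc
  eq t _ := by
    rw [intervalIntegral.integral_eq_sub_of_hasDerivAt (fun s _ => h s)
      (hf'.intervalIntegrable _ _)]
    abel

theorem IsPrimitive.add {l : ℝ} {f f' g g' : ℝ → E} (hf : IsPrimitive l f f')
    (hg : IsPrimitive l g g') : IsPrimitive l (fun t => f t + g t) (fun t => f' t + g' t) where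
  int := hf.int.add hg.int
  eq t ht := by
    rw [intervalIntegral.integral_add (intervalIntegrable_of_Icc ht hf.int)
      (intervalIntegrable_of_Icc ht hg.int), hf.eq t ht, hg.eq t ht]
    abel

theorem IsPrimitive.clm [CompleteSpace E] [CompleteSpace F] (L : E →L[ℝ] F) {l : ℝ} {f f' : ℝ → E} (hf : IsPrimitive l f f') :
    IsPrimitive l (fun t => L (f t)) (fun t => L (f' t)) where
  int := L.integrable_comp hf.int
  eq t ht := by
    rw [L.intervalIntegral_comp_comm (intervalIntegrable_of_Icc ht hf.int), hf.eq t ht, map_add]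

theorem IsPrimitive.congr_ae {l : ℝ} {f f' g g' : ℝ → E} (hf : IsPrimitive l f f')
    (h : ∀ t ∈ Icc 0 l, g t = f t) (h' : g' =ᵐ[segMeasure l] f') : IsPrimitive l g g' where
  int := hf.int.congr h'.symm
  eq t ht := by
    rw [h t ht, h 0 (left_mem_Icc.2 (ht.1.trans ht.2)), hf.eq t ht]
    congr 1
    refine intervalIntegral.integral_congr_ae ?_
    rw [uIoc_of_le ht.1]
    filter_upwards [(ae_restrict_iff' measurableSet_Icc).1 h'] with x hx hxt
    exact (hx ⟨hxt.1.le, hxt.2.trans ht.2⟩).symm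

theorem integrableOn_bilin_left (B : E →L[ℝ] F →L[ℝ] G) {l : ℝ} {f' : ℝ → E} {g : ℝ → F}
    (hf : IntegrableOn f' (Icc 0 l)) (hg : ContinuousOn g (Icc 0 l)) :
    IntegrableOn (fun t => B (f' t) (g t)) (Icc 0 l) := by
  obtain ⟨C, hC⟩ := isCompact_Icc.exists_bound_of_continuousOn hg
  refine Integrable.mono' (g := fun t => ‖B‖ * ‖f' t‖ * C) ((hf.norm.const_mul _).mul_const _)
    (B.aestronglyMeasurable_comp₂ hf.aestronglyMeasurable
      (hg.aestronglyMeasurable measurableSet_Icc)) ?_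
  filter_upwards [ae_restrict_mem measurableSet_Icc] with t ht
  exact (B.le_opNorm₂ _ _).trans (mul_le_mul_of_nonneg_left (hC t ht) (by positivity))

/-- Fubini on the triangle 0 < y ≤ x ≤ t. This is the only analytic input of the product rule, since
the derivatives are merely integrable. -/
theorem integral_bilin_primitive [CompleteSpace E] [CompleteSpace F] [CompleteSpace G] (B : E →L[ℝ] F →L[ℝ] G) {t : ℝ} (ht : 0 ≤ t) {f' : ℝ → E}
    {g' : ℝ → F} (hf : IntegrableOn f' (Icc 0 t)) (hg : IntegrableOn g' (Icc 0 t)) :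
    ∫ x in (0 : ℝ)..t, B (f' x) (∫ y in (0 : ℝ)..x, g' y)
      = ∫ y in (0 : ℝ)..t, B (∫ x in y..t, f' x) (g' y) := by
  have hf' : Integrable f' (volume.restrict (Ioc 0 t)) := hf.mono_set Ioc_subset_Icc_self
  have hg' : Integrable g' (volume.restrict (Ioc 0 t)) := hg.mono_set Ioc_subset_Icc_self
  have hK : Integrable (Function.uncurry fun x y => (Iic x).indicator (fun y => B (f' x) (g' y)) y)
      ((volume.restrict (Ioc 0 t)).prod (volume.restrict (Ioc 0 t))) := by
    have h1 := (hf'.op_fst_snd (op := fun x y => B x y) (by fun_prop)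
      ⟨‖B‖, B.le_opNorm₂⟩ hg').indicator
      (measurableSet_le measurable_snd measurable_fst : MeasurableSet {z : ℝ × ℝ | z.2 ≤ z.1})
    refine h1.congr (Filter.Eventually.of_forall fun z => ?_)
    simp only [Function.uncurry, indicator, mem_Iic, mem_ofPred_eq]
  have hsw := integral_integral_swap hK
  rw [intervalIntegral.integral_of_le ht, intervalIntegral.integral_of_le ht]
  refine Eq.trans ?_ (hsw.trans ?_)
  · refine setIntegral_congr_fun measurableSet_Ioc fun x hx => ?_
    rw [integral_indicator measurableSet_Iic, Measure.restrict_restrict measurableSet_Iic,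
      intervalIntegral.integral_of_le hx.1.le]
    have : Iic x ∩ Ioc 0 t = Ioc 0 x := by
      ext y
      simp only [mem_inter_iff, mem_Iic, mem_Ioc]
      exact ⟨fun h => ⟨h.2.1, h.1⟩, fun h => ⟨h.2, h.1, h.2.trans hx.2⟩⟩
    rw [this, ContinuousLinearMap.integral_comp_comm]
    exact hg.mono_set fun y hy => ⟨hy.1.le, hy.2.trans hx.2⟩
  · refine setIntegral_congr_fun measurableSet_Ioc fun y hy => ?_
    have h1 : ∀ x, (Iic x).indicator (fun y => B (f' x) (g' y)) y
        = (Ici y).indicator (fun x => B.flip (g' y) (f' x)) x := fun x => by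
      simp only [indicator, mem_Iic, mem_Ici, ContinuousLinearMap.flip_apply]
    simp only [h1]
    -- The section of the triangle at fixed y is the closed interval [y,t]; its left end point is a
    -- null set.
    rw [integral_indicator measurableSet_Ici, Measure.restrict_restrict measurableSet_Ici,
      intervalIntegral.integral_of_le hy.2, ← integral_Icc_eq_integral_Ioc]
    have : Ici y ∩ Ioc 0 t = Icc y t := by
      ext x
      simp only [mem_inter_iff, mem_Ici, mem_Ioc, mem_Icc]
      exact ⟨fun h => ⟨h.1, h.2.2⟩, fun h => ⟨h.1, hy.1.trans_le h.1, h.2⟩⟩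
    rw [this, ContinuousLinearMap.integral_comp_comm, ContinuousLinearMap.flip_apply]
    exact hf.mono_set (Icc_subset_Icc_left hy.1.le)

/-- Product rule for absolutely continuous functions and a continuous bilinear map. -/
theorem IsPrimitive.bilin [CompleteSpace E] [CompleteSpace F] [CompleteSpace G] (B : E →L[ℝ] F →L[ℝ] G) {l : ℝ} {f f' : ℝ → E} {g g' : ℝ → F}
    (hf : IsPrimitive l f f') (hg : IsPrimitive l g g') :
    IsPrimitive l (fun t => B (f t) (g t)) (fun t => B (f' t) (g t) + B (f t) (g' t)) := by
  have h1 := integrableOn_bilin_left B hf.int hg.continuousOn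
  have h2 := integrableOn_bilin_left B.flip hg.int hf.continuousOn
  simp only [ContinuousLinearMap.flip_apply] at h2
  refine ⟨h1.add h2, fun t ht => ?_⟩
  have hft : IntegrableOn f' (Icc 0 t) := hf.int.mono_set (Icc_subset_Icc_right ht.2)
  have hgt : IntegrableOn g' (Icc 0 t) := hg.int.mono_set (Icc_subset_Icc_right ht.2)
  rw [intervalIntegral.integral_add (intervalIntegrable_of_Icc ht h1)
    (intervalIntegrable_of_Icc ht h2)]
  -- Here g is expanded from the left end and, in `e2`, f from the right end. The two double
  -- integrals are then equal by Fubini and cancel.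
  have e1 : ∫ s in (0 : ℝ)..t, B (f' s) (g s)
      = B (∫ s in (0 : ℝ)..t, f' s) (g 0)
        + ∫ x in (0 : ℝ)..t, B (f' x) (∫ y in (0 : ℝ)..x, g' y) := by
    have := ((B.flip (g 0)).intervalIntegral_comp_comm (intervalIntegrable_of_Icc ht hf.int))
    simp only [ContinuousLinearMap.flip_apply] at this
    rw [← this, ← intervalIntegral.integral_add]
    · refine intervalIntegral.integral_congr fun s hs => ?_
      rw [uIcc_of_le ht.1] at hs
      rw [hg.eq s ⟨hs.1, hs.2.trans ht.2⟩, map_add]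
    · exact intervalIntegrable_of_Icc ht ((B.flip (g 0)).integrable_comp hf.int)
    · refine intervalIntegrable_of_Icc ht (integrableOn_bilin_left B hf.int ?_)
      exact (hg.continuousOn.sub (continuousOn_const (c := g 0))).congr fun s hs => by
        rw [Pi.sub_apply, hg.eq s hs, add_sub_cancel_left]
  have e2 : ∫ s in (0 : ℝ)..t, B (f s) (g' s)
      = B (f t) (∫ s in (0 : ℝ)..t, g' s)
        - ∫ y in (0 : ℝ)..t, B (∫ x in y..t, f' x) (g' y) := by
    have hint : ∀ s ∈ Icc 0 t, ∫ x in s..t, f' x = f t - f s := fun s hs => by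
      rw [hf.eq t ht, hf.eq s ⟨hs.1, hs.2.trans ht.2⟩, add_sub_add_left_eq_sub,
        intervalIntegral.integral_interval_sub_left]
      · exact intervalIntegrable_of_Icc ht hf.int
      · exact intervalIntegrable_of_Icc ⟨hs.1, hs.2.trans ht.2⟩ hf.int
    rw [← (B (f t)).intervalIntegral_comp_comm (intervalIntegrable_of_Icc ht hg.int),
      ← intervalIntegral.integral_sub]
    · refine intervalIntegral.integral_congr fun s hs => ?_
      rw [uIcc_of_le ht.1] at hs
      rw [hint s hs, map_sub, sub_apply, sub_sub_cancel]
    · exact intervalIntegrable_of_Icc ht ((B (f t)).integrable_comp hg.int)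
    · refine intervalIntegrable_of_Icc (right_mem_Icc.2 ht.1) ?_
      have hcont : ContinuousOn (fun s => ∫ x in s..t, f' x) (Icc 0 t) :=
        (continuousOn_const.sub (hf.continuousOn.mono (Icc_subset_Icc_right ht.2))).congr hint
      simpa only [ContinuousLinearMap.flip_apply] using
        integrableOn_bilin_left B.flip hgt hcont
  rw [e1, e2, integral_bilin_primitive B ht.1 hft hgt]
  have i1 : ∫ s in (0 : ℝ)..t, f' s = f t - f 0 := by rw [hf.eq t ht, add_sub_cancel_left]
  have i2 : ∫ s in (0 : ℝ)..t, g' s = g t - g 0 := by rw [hg.eq t ht, add_sub_cancel_left]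
  rw [i1, i2]
  simp only [map_sub, sub_apply]
  abel

end Primitive

/-! ### The matrix potential on an edge and its gauge transformation -/

namespace RashbaNetwork

variable (N : RashbaNetwork)

theorem contDiff_a (e : N.edge) : ContDiff ℝ 1 (N.a e) :=
  (N.A_contDiff.comp (contDiff_const.add (contDiff_id.smul contDiff_const))).inner ℝ contDiff_const

theorem continuous_a (e : N.edge) : Continuous (N.a e) := (N.contDiff_a e).continuous

theorem continuous_deriv_a (e : N.edge) : Continuous (deriv (N.a e)) :=
  (N.contDiff_a e).continuous_deriv le_rfl

theorem hasDerivAt_a (e : N.edge) (t : ℝ) : HasDerivAt (N.a e) (deriv (N.a e) t) t :=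
  ((N.contDiff_a e).differentiable one_ne_zero t).hasDerivAt

/-- The Rashba term `k_R σ` on an edge. -/
def rashba (e : N.edge) : Spin →L[ℂ] Spin := (N.kR : ℂ) • (N.spinMat e).toContinuousLinearMap

/-- The matrix potential `a + k_R σ` on an edge. -/
def pot (e : N.edge) (t : ℝ) : Spin →L[ℂ] Spin := (N.a e t : ℂ) • 1 + N.rashba e

theorem pot_apply (e : N.edge) (t : ℝ) (x : Spin) :
    N.pot e t x = (N.a e t : ℂ) • x + (N.kR : ℂ) • N.spinMat e x := rfl

theorem isSymmetric_rashba (e : N.edge) (x y : Spin) :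
    inner ℂ (N.rashba e x) y = inner ℂ x (N.rashba e y) := by
  have h : (N.spinMat e).IsSymmetric := by
    refine Matrix.isSymmetric_toEuclideanLin_iff.2 ?_
    ext i j
    fin_cases i <;> fin_cases j <;> simp [Matrix.conjTranspose_apply, sub_eq_add_neg]
  have h' := h x y
  simp only [rashba, smul_apply, LinearMap.coe_toContinuousLinearMap',
    inner_smul_left, inner_smul_right, Complex.conj_ofReal, h']

theorem isSymmetric_pot (e : N.edge) (t : ℝ) (x y : Spin) :
    inner ℂ (N.pot e t x) y = inner ℂ x (N.pot e t y) := by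
  simp only [pot, add_apply, smul_apply,
    one_apply_eq_self, inner_add_left, inner_add_right,
    inner_smul_left, inner_smul_right, Complex.conj_ofReal, N.isSymmetric_rashba e x y]

theorem hasDerivAt_pot (e : N.edge) (t : ℝ) :
    HasDerivAt (N.pot e) (((deriv (N.a e) t : ℝ) : ℂ) • (1 : Spin →L[ℂ] Spin)) t :=
  ((N.hasDerivAt_a e t).ofReal_comp.smul_const _).add_const _

theorem continuous_pot (e : N.edge) : Continuous (N.pot e) :=
  continuous_iff_continuousAt.2 fun t => (N.hasDerivAt_pot e t).continuousAt

/-- The unitary gauge transformation that removes the matrix potential of an edge. -/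
def gauge (e : N.edge) (t : ℝ) : Spin →L[ℂ] Spin :=
  Complex.exp (Complex.I * ((∫ s in (0 : ℝ)..t, N.a e s : ℝ) : ℂ)) •
    NormedSpace.exp ((t : ℂ) • (Complex.I • N.rashba e))

theorem gauge_zero (e : N.edge) : N.gauge e 0 = 1 := by
  have h : ((0 : ℝ) : ℂ) • (Complex.I • N.rashba e) = 0 := by
    rw [Complex.ofReal_zero]
    exact zero_smul ℂ (Complex.I • N.rashba e)
  rw [gauge, h, NormedSpace.exp_zero]
  simp

/-- The scalar phase commutes with everything and σ_e does not depend on t, so a plain product of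
exponentials solves the linear equation and no ordered exponential is needed. -/
theorem hasDerivAt_gauge (e : N.edge) (t : ℝ) :
    HasDerivAt (N.gauge e) (Complex.I • (N.pot e t * N.gauge e t)) t := by
  have h1 : HasDerivAt (fun t : ℝ => ∫ s in (0 : ℝ)..t, N.a e s) (N.a e t) t :=
    intervalIntegral.integral_hasDerivAt_right ((N.continuous_a e).intervalIntegrable _ _)
      ((N.continuous_a e).stronglyMeasurableAtFilter _ _) (N.continuous_a e).continuousAt
  have h2 := (h1.ofReal_comp.const_mul Complex.I).cexp
  have h3 := (hasDerivAt_exp_smul_const' (Complex.I • N.rashba e) (t : ℂ)).scomp t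
    Complex.ofRealCLM.hasDerivAt
  refine (h2.smul h3).congr_deriv ?_
  simp only [gauge, pot, add_mul, smul_mul_assoc, mul_smul_comm, one_mul, smul_add, smul_smul]
  rw [add_comm]
  congr 2
  · ring
  · simp [mul_comm]

theorem continuous_gauge (e : N.edge) : Continuous (N.gauge e) :=
  continuous_iff_continuousAt.2 fun t => (N.hasDerivAt_gauge e t).continuousAt

/-- Both arguments solve y' = i P y with P symmetric, so the derivative of their inner product
vanishes; at t = 0 the gauge is the identity. -/
theorem inner_gauge (e : N.edge) (t : ℝ) (x y : Spin) :
    inner ℂ (N.gauge e t x) (N.gauge e t y) = inner ℂ x y := by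
  have h : ∀ (x : Spin) t, HasDerivAt (fun t => N.gauge e t x)
      (Complex.I • N.pot e t (N.gauge e t x)) t := fun x t => by
    exact ((ContinuousLinearMap.apply ℂ Spin x).restrictScalars ℝ).hasFDerivAt.comp_hasDerivAt t
      (N.hasDerivAt_gauge e t)
  have hd : ∀ t, HasDerivAt (fun t => inner ℂ (N.gauge e t x) (N.gauge e t y)) 0 t := fun t => by
    refine ((h x t).inner ℂ (h y t)).congr_deriv ?_
    rw [inner_smul_left, inner_smul_right, N.isSymmetric_pot]
    simp
  have := is_const_of_deriv_eq_zero (fun t => (hd t).differentiableAt) (fun t => (hd t).deriv) t 0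
  simpa [gauge_zero] using this

theorem norm_gauge (e : N.edge) (t : ℝ) (x : Spin) : ‖N.gauge e t x‖ = ‖x‖ := by
  rw [@norm_eq_sqrt_re_inner ℂ, @norm_eq_sqrt_re_inner ℂ _ _ _ _ x, inner_gauge]

/-- The inverse of the gauge transformation. -/
def gaugeInv (e : N.edge) (t : ℝ) : Spin →L[ℂ] Spin := ContinuousLinearMap.adjoint (N.gauge e t)

theorem gaugeInv_gauge (e : N.edge) (t : ℝ) (x : Spin) : N.gaugeInv e t (N.gauge e t x) = x :=
  ext_inner_right ℂ fun y => by rw [gaugeInv, ContinuousLinearMap.adjoint_inner_left, inner_gauge]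

/-- The adjoint is a left inverse by isometry; in finite dimension injectivity makes it a right
inverse. -/
theorem gauge_gaugeInv (e : N.edge) (t : ℝ) (x : Spin) : N.gauge e t (N.gaugeInv e t x) = x := by
  have hinj : Function.Injective (N.gauge e t).toLinearMap :=
    Function.LeftInverse.injective (g := N.gaugeInv e t) (N.gaugeInv_gauge e t)
  obtain ⟨y, rfl⟩ := LinearMap.injective_iff_surjective.1 hinj x
  exact congrArg (N.gauge e t) (N.gaugeInv_gauge e t y)

theorem norm_gaugeInv (e : N.edge) (t : ℝ) (x : Spin) : ‖N.gaugeInv e t x‖ = ‖x‖ := by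
  rw [← N.norm_gauge e t, gauge_gaugeInv]

theorem continuous_gaugeInv (e : N.edge) : Continuous (N.gaugeInv e) :=
  (ContinuousLinearMap.adjoint (𝕜 := ℂ) (E := Spin) (F := Spin)).continuous.comp
    (N.continuous_gauge e)

theorem inner_gauge_left (e : N.edge) (t : ℝ) (x y : Spin) :
    inner ℂ (N.gauge e t x) y = inner ℂ x (N.gaugeInv e t y) :=
  (ContinuousLinearMap.adjoint_inner_right _ _ _).symm

variable {N}

/-- Application of complex-linear operators as a real bilinear map. -/
def applyBilin : (Spin →L[ℂ] Spin) →L[ℝ] Spin →L[ℝ] Spin :=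
  ContinuousLinearMap.restrictScalarsL ℂ Spin Spin ℝ ℝ

theorem isPrimitive_pot {l : ℝ} (e : N.edge) {f f' : ℝ → Spin} (hf : IsPrimitive l f f') :
    IsPrimitive l (fun t => N.pot e t (f t))
      (fun t => ((deriv (N.a e) t : ℝ) : ℂ) • f t + N.pot e t (f' t)) := by
  have h := (IsPrimitive.of_hasDerivAt (N.hasDerivAt_pot e)
    ((Complex.continuous_ofReal.comp (N.continuous_deriv_a e)).smul continuous_const) l).bilin
      applyBilin hf
  exact h

theorem isPrimitive_gauge {l : ℝ} (e : N.edge) {f f' : ℝ → Spin} (hf : IsPrimitive l f f') :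
    IsPrimitive l (fun t => N.gauge e t (f t))
      (fun t => Complex.I • N.pot e t (N.gauge e t (f t)) + N.gauge e t (f' t)) := by
  have h := (IsPrimitive.of_hasDerivAt (N.hasDerivAt_gauge e)
    (((N.continuous_pot e).mul (N.continuous_gauge e)).const_smul Complex.I) l).bilin
      applyBilin hf
  exact h

end RashbaNetwork

/-! ### Integration on a segment and regularity of weak solutions -/

section Segment

/-- The inner product as a real bilinear map. -/
def innerBilin : Spin →L[ℝ] Spin →L[ℝ] ℂ :=
  (isBoundedBilinearMap_inner (𝕜 := ℂ) (E := Spin)).toContinuousLinearMap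

theorem innerBilin_apply (x y : Spin) : innerBilin x y = inner ℂ x y := rfl

theorem integral_seg {E : Type*} [NormedAddCommGroup E] [NormedSpace ℝ E] {l : ℝ} (hl : 0 ≤ l)
    (f : ℝ → E) : ∫ t, f t ∂segMeasure l = ∫ t in (0 : ℝ)..l, f t := by
  rw [intervalIntegral.integral_of_le hl, segMeasure, integral_Icc_eq_integral_Ioc]

theorem IsPrimitive.integral_seg {E : Type*} [NormedAddCommGroup E] [NormedSpace ℝ E] {l : ℝ}
    (hl : 0 ≤ l) {f f' : ℝ → E} (h : IsPrimitive l f f') :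
    ∫ t, f' t ∂segMeasure l = f l - f 0 := by
  rw [_root_.integral_seg hl, h.eq l (right_mem_Icc.2 hl), add_sub_cancel_left]

theorem IsPrimitive.integral {E : Type*} [NormedAddCommGroup E] [NormedSpace ℝ E] {l : ℝ}
    {f' : ℝ → E} (h : IntegrableOn f' (Icc 0 l)) (x : E) :
    IsPrimitive l (fun t => x + ∫ s in (0 : ℝ)..t, f' s) f' where
  int := h
  eq t _ := by simp

theorem integrable_inner_of_memLp {μ : Measure ℝ} {f g : ℝ → Spin} (hf : MemLp f 2 μ)
    (hg : MemLp g 2 μ) : Integrable (fun t => inner ℂ (f t) (g t)) μ := by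
  have h := L2.integrable_inner (𝕜 := ℂ) hf.toLp hg.toLp
  refine h.congr ?_
  filter_upwards [hf.coeFn_toLp, hg.coeFn_toLp] with t h1 h2
  rw [h1, h2]

theorem memLp_of_continuousOn {l : ℝ} {f : ℝ → Spin} (hf : ContinuousOn f (Icc 0 l)) :
    MemLp f 2 (segMeasure l) := by
  obtain ⟨C, hC⟩ := isCompact_Icc.exists_bound_of_continuousOn hf
  refine MemLp.of_bound (hf.aestronglyMeasurable measurableSet_Icc) C ?_
  filter_upwards [ae_restrict_mem measurableSet_Icc] with t ht using hC t ht

/-- The potential is only in L², so the other factor has to be bounded in the supremum norm. -/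
theorem eLpNorm_smul_le_of_bound {l : ℝ} {V : ℝ → ℝ} {f : ℝ → Spin} {C : ℝ}
    (hf : ∀ t ∈ Icc 0 l, ‖f t‖ ≤ C) :
    eLpNorm (fun t => (V t : ℂ) • f t) 2 (segMeasure l)
      ≤ ENNReal.ofReal C * eLpNorm V 2 (segMeasure l) := by
  refine eLpNorm_le_mul_eLpNorm_of_ae_le_mul ?_ 2
  filter_upwards [ae_restrict_mem measurableSet_Icc] with t ht
  rw [norm_smul, Complex.norm_real, mul_comm]
  exact mul_le_mul_of_nonneg_right (hf t ht) (norm_nonneg _)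

theorem memLp_smul_of_continuousOn {l : ℝ} {V : ℝ → ℝ} (hV : MemLp V 2 (segMeasure l))
    {f : ℝ → Spin} (hf : ContinuousOn f (Icc 0 l)) :
    MemLp (fun t => (V t : ℂ) • f t) 2 (segMeasure l) := by
  obtain ⟨C, hC⟩ := isCompact_Icc.exists_bound_of_continuousOn hf
  refine ⟨(Complex.continuous_ofReal.comp_aestronglyMeasurable hV.aestronglyMeasurable).smul
    (hf.aestronglyMeasurable measurableSet_Icc), ?_⟩
  exact (eLpNorm_smul_le_of_bound hC).trans_lt (ENNReal.mul_lt_top ENNReal.ofReal_lt_top hV.2)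

/-- A pair of moments on a segment is attained by an affine function. -/
theorem exists_affine_moments {l : ℝ} (hl : 0 < l) {q : ℝ → Spin}
    (hq : MemLp q 2 (segMeasure l)) :
    ∃ x y : Spin, (∫ t, (q t - (x + t • y)) ∂segMeasure l) = 0 ∧
      (∫ t, t • (q t - (x + t • y)) ∂segMeasure l) = 0 := by
  have hq1 : Integrable q (segMeasure l) := hq.integrable (by norm_num)
  have hq2 : Integrable (fun t => t • q t) (segMeasure l) :=
    integrableOn_bilin_left (ContinuousLinearMap.lsmul ℝ ℝ).flip hq1 continuousOn_id
  set m := ∫ t, q t ∂segMeasure l with hm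
  set n := ∫ t, t • q t ∂segMeasure l with hn
  have hc : ∀ f : ℝ → Spin, Continuous f → Integrable f (segMeasure l) :=
    fun f hf => hf.continuousOn.integrableOn_Icc
  have i0 : ∀ x : Spin, ∫ _t, x ∂segMeasure l = l • x := fun x => by
    rw [integral_seg hl.le]; simp
  have i1 : ∀ x : Spin, ∫ t, t • x ∂segMeasure l = (l ^ 2 / 2) • x := fun x => by
    rw [integral_seg hl.le, intervalIntegral.integral_smul_const, integral_id]; simp
  have i2 : ∀ x : Spin, ∫ t, t • t • x ∂segMeasure l = (l ^ 3 / 3) • x := fun x => by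
    simp only [smul_smul, ← pow_two]
    rw [integral_seg hl.le, intervalIntegral.integral_smul_const, integral_pow]; norm_num
  -- The affine function must satisfy l x + (l²/2) y = m and (l²/2) x + (l³/3) y = n. Subtracting
  -- l/2 times the first equation from the second leaves (l³/12) y = n - (l/2) m.
  set y : Spin := (12 / l ^ 3) • (n - (l / 2) • m) with hy
  set x : Spin := (1 / l) • m - (l / 2) • y with hx
  refine ⟨x, y, ?_, ?_⟩
  · rw [integral_sub hq1 (hc _ (by fun_prop)), integral_add (hc _ (by fun_prop))
      (hc _ (by fun_prop)), i0, i1, ← hm, hx]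
    simp only [smul_sub, smul_smul]
    rw [mul_one_div_cancel hl.ne', show l * (l / 2) = l ^ 2 / 2 by ring, one_smul]
    abel
  · simp only [smul_sub, smul_add]
    rw [integral_sub hq2 (hc _ (by fun_prop)), integral_add (hc _ (by fun_prop))
      (hc _ (by fun_prop)), i1, i2, ← hn, hx]
    have hn' : n = (l ^ 3 / 12) • y + (l / 2) • m := by
      rw [hy, smul_smul, div_mul_div_comm, mul_comm (l ^ 3), div_self (by positivity), one_smul,
        sub_add_cancel]
    rw [hn']
    simp only [smul_sub, smul_smul]
    rw [show l ^ 2 / 2 * (1 / l) = l / 2 by field_simp]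
    module

/-- Weak solutions of `-y'' + V y = k` on a segment, tested with functions that vanish to first
order at the end points, are twice differentiable. -/
theorem exists_primitive_of_weak {l : ℝ} (hl : 0 < l) {V : ℝ → ℝ} (hV : MemLp V 2 (segMeasure l))
    {y k : ℝ → Spin} (hy : MemLp y 2 (segMeasure l)) (hk : MemLp k 2 (segMeasure l))
    (H : ∀ u u' u'' : ℝ → Spin, IsPrimitive l u u' → IsPrimitive l u' u'' →
      MemLp u'' 2 (segMeasure l) → u 0 = 0 → u l = 0 → u' 0 = 0 → u' l = 0 →
      ∫ t, inner ℂ (u t) (k t) ∂segMeasure l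
        = ∫ t, inner ℂ (-u'' t + (V t : ℂ) • u t) (y t) ∂segMeasure l) :
    ∃ z z' z'' : ℝ → Spin, IsPrimitive l z z' ∧ IsPrimitive l z' z'' ∧
      MemLp z'' 2 (segMeasure l) ∧ y =ᵐ[segMeasure l] z ∧
      k =ᵐ[segMeasure l] fun t => -z'' t + (V t : ℂ) • z t := by
  -- As a product of two L² functions, V y is only known to be integrable here. Its square
  -- integrability follows at the end, once y has a continuous representative.
  have hVy : Integrable (fun t => (V t : ℂ) • y t) (segMeasure l) := by
    exact memLp_one_iff_integrable.1 (hy.smul (hV.ofReal (K := ℂ)))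
  have hG : IntegrableOn (fun t => (V t : ℂ) • y t - k t) (Icc 0 l) :=
    hVy.sub (hk.integrable (by norm_num))
  -- `G` is the expected second derivative of y, and `F` below is a second primitive of it. The aim
  -- is that y - F is affine.
  set G := fun t => (V t : ℂ) • y t - k t with hGdef
  have hF' := IsPrimitive.integral hG 0
  set F' := fun t => (0 : Spin) + ∫ s in (0 : ℝ)..t, G s
  have hF := IsPrimitive.integral (hF'.continuousOn.integrableOn_Icc) 0
  set F := fun t => (0 : Spin) + ∫ s in (0 : ℝ)..t, F' s
  have hFL := memLp_of_continuousOn hF.continuousOn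
  have hq : MemLp (fun t => y t - F t) 2 (segMeasure l) := hy.sub hFL
  -- The affine part is chosen so that the remainder `w` has vanishing moments of order 0 and 1.
  -- Exactly then its second primitive `u` vanishes to first order at both ends and is an admissible
  -- test function.
  obtain ⟨x, v, hm0, hm1⟩ := exists_affine_moments hl hq
  have hp : Continuous fun t : ℝ => x + t • v := by fun_prop
  set w := fun t => y t - F t - (x + t • v) with hw
  have hwL : MemLp w 2 (segMeasure l) := hq.sub (memLp_of_continuousOn hp.continuousOn)
  have hw1 : Integrable w (segMeasure l) := hwL.integrable (by norm_num)
  have hu' := IsPrimitive.integral hw1 0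
  set u' := fun t => (0 : Spin) + ∫ s in (0 : ℝ)..t, w s with hu'def
  have hu := IsPrimitive.integral (hu'.continuousOn.integrableOn_Icc) 0
  set u := fun t => (0 : Spin) + ∫ s in (0 : ℝ)..t, u' s with hudef
  have u0 : u 0 = 0 := by simp [hudef]
  have u'0 : u' 0 = 0 := by simp [hu'def]
  have u'l : u' l = 0 := by
    have := hu'.integral_seg hl.le
    rw [hm0, u'0, sub_zero] at this
    exact this.symm
  -- Integrating (t u')' = u' + t w over the segment, where u'(l) = 0 and the first moment of w
  -- vanishes, gives u(l) = u(0).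
  have ul : u l = 0 := by
    have hid : IsPrimitive l (fun t : ℝ => t) (fun _ => (1 : ℝ)) :=
      IsPrimitive.of_hasDerivAt (fun t => hasDerivAt_id t) continuous_const l
    have h1 := (hid.bilin (ContinuousLinearMap.lsmul ℝ ℝ) hu').integral_seg hl.le
    simp only [ContinuousLinearMap.lsmul_apply, one_smul, u'l, smul_zero, zero_smul,
      sub_zero] at h1
    have h2 : Integrable (fun t => t • w t) (segMeasure l) :=
      integrableOn_bilin_left (ContinuousLinearMap.lsmul ℝ ℝ).flip hw1 continuousOn_id
    rw [integral_add hu.int h2, hm1, add_zero, hu.integral_seg hl.le, u0, sub_zero] at h1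
    exact h1
  have key := H u u' w hu hu' hwL u0 ul u'0 u'l
  have huL := memLp_of_continuousOn hu.continuousOn
  have iG : Integrable (fun t => inner ℂ (u t) (G t)) (segMeasure l) :=
    integrableOn_bilin_left innerBilin.flip hG hu.continuousOn
  -- Two integrations by parts; all boundary terms vanish.
  have e1 : ∫ t, inner ℂ (u t) (G t) ∂segMeasure l = ∫ t, inner ℂ (w t) (F t) ∂segMeasure l := by
    have h1 := (hu.bilin innerBilin hF').integral_seg hl.le
    have h2 := (hu'.bilin innerBilin hF).integral_seg hl.le
    simp only [innerBilin_apply, ul, u0, u'l, u'0, inner_zero_left, sub_zero] at h1 h2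
    rw [integral_add (integrable_inner_of_memLp (memLp_of_continuousOn hu'.continuousOn)
      (memLp_of_continuousOn hF'.continuousOn)) iG] at h1
    rw [integral_add (integrable_inner_of_memLp hwL hFL)
      (integrable_inner_of_memLp (memLp_of_continuousOn hu'.continuousOn)
      (memLp_of_continuousOn hF'.continuousOn))] at h2
    linear_combination h1 - h2
  -- The weak equation for the test function u, with u'' = w, and V moved across the inner product
  -- because it is real.
  have e2 : ∫ t, inner ℂ (w t) (y t) ∂segMeasure l = ∫ t, inner ℂ (u t) (G t) ∂segMeasure l := by
    have h1 : ∫ t, inner ℂ (-w t + (V t : ℂ) • u t) (y t) ∂segMeasure l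
        = ∫ t, (inner ℂ (u t) (G t) + inner ℂ (u t) (k t) - inner ℂ (w t) (y t))
          ∂segMeasure l := by
      refine integral_congr_ae (Filter.Eventually.of_forall fun t => ?_)
      simp only [hGdef, inner_add_left, inner_neg_left, inner_smul_left, inner_sub_right,
        inner_smul_right, Complex.conj_ofReal]
      ring
    have iuk := integrable_inner_of_memLp huL hk
    have iadd : Integrable (fun t => inner ℂ (u t) (G t) + inner ℂ (u t) (k t)) (segMeasure l) :=
      iG.add iuk
    rw [h1, integral_sub iadd (integrable_inner_of_memLp hwL hy), integral_add iG iuk] at key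
    linear_combination key
  have e3 : ∫ t, inner ℂ (w t) (x + t • v) ∂segMeasure l = 0 := by
    have hw2 : Integrable (fun t => t • w t) (segMeasure l) :=
      integrableOn_bilin_left (ContinuousLinearMap.lsmul ℝ ℝ).flip hw1 continuousOn_id
    have h1 := (innerBilin.flip x).integral_comp_comm hw1
    have h2 := (innerBilin.flip v).integral_comp_comm hw2
    rw [hm0, map_zero] at h1
    rw [hm1, map_zero] at h2
    simp only [ContinuousLinearMap.flip_apply, innerBilin_apply] at h1 h2
    have h3 : ∀ t, inner ℂ (w t) (x + t • v) = inner ℂ (w t) x + inner ℂ (t • w t) v := fun t => by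
      simp
    simp only [h3]
    rw [integral_add, h1, h2, add_zero]
    · exact (innerBilin.flip x).integrable_comp hw1
    · exact (innerBilin.flip v).integrable_comp hw2
  -- One factor w is expanded as y - F minus the affine part: the first two terms cancel by `e1` and
  -- `e2`, the last vanishes by `e3`.
  have e4 : ∫ t, inner ℂ (w t) (w t) ∂segMeasure l = 0 := by
    have h1 : ∫ t, inner ℂ (w t) (w t) ∂segMeasure l = ∫ t, (inner ℂ (w t) (y t)
        - inner ℂ (w t) (F t) - inner ℂ (w t) (x + t • v)) ∂segMeasure l := by
      refine integral_congr_ae (Filter.Eventually.of_forall fun t => ?_)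
      dsimp only
      rw [← inner_sub_right, ← inner_sub_right]
    rw [h1, integral_sub, integral_sub, e3, e2, e1, sub_self, sub_zero]
    · exact integrable_inner_of_memLp hwL hy
    · exact integrable_inner_of_memLp hwL hFL
    · exact (integrable_inner_of_memLp hwL hy).sub (integrable_inner_of_memLp hwL hFL)
    · exact integrable_inner_of_memLp hwL (memLp_of_continuousOn hp.continuousOn)
  have hw0 : w =ᵐ[segMeasure l] 0 := by
    have h1 : inner ℂ hwL.toLp hwL.toLp = (0 : ℂ) := by
      rw [L2.inner_def, ← e4]
      refine integral_congr_ae ?_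
      filter_upwards [hwL.coeFn_toLp] with t ht
      rw [ht]
    exact (MemLp.toLp_eq_toLp_iff hwL MemLp.zero).1
      ((inner_self_eq_zero.1 h1).trans (MemLp.toLp_zero _).symm)
  have hyz : y =ᵐ[segMeasure l] fun t => F t + (x + t • v) := by
    filter_upwards [hw0] with t ht
    rw [hw] at ht
    simpa [sub_sub, sub_eq_zero] using ht
  have hlin : IsPrimitive l (fun t : ℝ => x + t • v) (fun _ => v) :=
    IsPrimitive.of_hasDerivAt (fun t => by
      simpa using ((hasDerivAt_id t).smul_const v).const_add x) continuous_const l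
  have hz := hF.add hlin
  have hz' := hF'.add (IsPrimitive.of_hasDerivAt (fun t => hasDerivAt_const t v)
    continuous_const l)
  simp only [add_zero] at hz'
  refine ⟨_, _, G, hz, hz', ?_, hyz, ?_⟩
  -- With y replaced by its continuous representative, V y is in L², hence so is `G`.
  · refine ((memLp_smul_of_continuousOn hV hz.continuousOn).sub hk).ae_eq ?_
    filter_upwards [hyz] with t ht
    simp only [Pi.sub_apply, hGdef, ht]
  · filter_upwards [hyz] with t ht
    simp only [hGdef, ← ht]
    abel

end Segment

/-! ### Cubic Hermite interpolation -/

section Hermite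

/-- Cubic Hermite interpolation on a segment, with bounds. -/
theorem exists_hermite {l : ℝ} (hl : 0 < l) (x₀ x₁ y₀ y₁ : Spin) :
    ∃ u u' u'' : ℝ → Spin, IsPrimitive l u u' ∧ IsPrimitive l u' u'' ∧ Continuous u'' ∧
      u 0 = x₀ ∧ u l = x₁ ∧ u' 0 = y₀ ∧ u' l = y₁ ∧
      (∀ t ∈ Icc 0 l, ‖u t‖ ≤ (6 + 4 * l) * (‖x₀‖ + ‖x₁‖ + ‖y₀‖ + ‖y₁‖)) ∧
      ∀ t ∈ Icc 0 l, ‖u'' t‖ ≤ (18 + 10 * l) / l ^ 2 * (‖x₀‖ + ‖x₁‖ + ‖y₀‖ + ‖y₁‖) := by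
  -- The coefficients of t² and t³ in the cubic with value x₀ and slope y₀ at 0, solved from value
  -- x₁ and slope y₁ at l.
  set a : Spin := (3 / l ^ 2) • (x₁ - x₀) - (1 / l) • ((2 : ℝ) • y₀ + y₁) with ha
  set b : Spin := (2 / l ^ 3) • (x₀ - x₁) + (1 / l ^ 2) • (y₀ + y₁) with hb
  set s := ‖x₀‖ + ‖x₁‖ + ‖y₀‖ + ‖y₁‖ with hs
  have p1 := norm_nonneg x₀
  have p2 := norm_nonneg x₁
  have p3 := norm_nonneg y₀
  have p4 := norm_nonneg y₁
  have hx : ‖x₁ - x₀‖ ≤ s := (norm_sub_le _ _).trans (by rw [hs]; linarith)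
  have hx' : ‖x₀ - x₁‖ ≤ s := by rwa [norm_sub_rev]
  have hy : ‖y₀ + y₁‖ ≤ s := (norm_add_le _ _).trans (by rw [hs]; linarith)
  have hy' : ‖(2 : ℝ) • y₀ + y₁‖ ≤ 2 * s := (norm_add_le _ _).trans (by
    rw [norm_smul, Real.norm_ofNat, hs]; linarith)
  have hna : ‖a‖ ≤ (3 + 2 * l) / l ^ 2 * s := by
    calc ‖a‖ ≤ 3 / l ^ 2 * ‖x₁ - x₀‖ + 1 / l * ‖(2 : ℝ) • y₀ + y₁‖ := by
          refine (norm_sub_le _ _).trans_eq ?_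
          rw [norm_smul, norm_smul, Real.norm_of_nonneg (by positivity),
            Real.norm_of_nonneg (by positivity)]
      _ ≤ 3 / l ^ 2 * s + 1 / l * (2 * s) := by gcongr
      _ = _ := by field_simp
  have hnb : ‖b‖ ≤ (2 + l) / l ^ 3 * s := by
    calc ‖b‖ ≤ 2 / l ^ 3 * ‖x₀ - x₁‖ + 1 / l ^ 2 * ‖y₀ + y₁‖ := by
          refine (norm_add_le _ _).trans_eq ?_
          rw [norm_smul, norm_smul, Real.norm_of_nonneg (by positivity),
            Real.norm_of_nonneg (by positivity)]
      _ ≤ 2 / l ^ 3 * s + 1 / l ^ 2 * s := by gcongr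
      _ = _ := by field_simp
  refine ⟨fun t => x₀ + t • y₀ + t ^ 2 • a + t ^ 3 • b, fun t => y₀ + (2 * t) • a + (3 * t ^ 2) • b,
    fun t => (2 : ℝ) • a + (6 * t) • b, ?_, ?_, by fun_prop, by simp, ?_, by simp, ?_, ?_, ?_⟩
  · refine IsPrimitive.of_hasDerivAt (fun t => ?_) (by fun_prop) l
    refine (((((hasDerivAt_id t).smul_const y₀).const_add x₀).add
      (((hasDerivAt_id t).pow 2).smul_const a)).add
      (((hasDerivAt_id t).pow 3).smul_const b)).congr_deriv ?_
    simp
  · refine IsPrimitive.of_hasDerivAt (fun t => ?_) (by fun_prop) l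
    refine (((((hasDerivAt_id t).const_mul 2).smul_const a).const_add y₀).add
      ((((hasDerivAt_id t).pow 2).const_mul 3).smul_const b)).congr_deriv ?_
    simp only [mul_one, id_eq, Nat.cast_ofNat, Nat.add_one_sub_one, pow_one]
    ring_nf
  · simp only [ha, hb, smul_add, smul_sub, smul_smul]
    match_scalars <;> field_simp <;> ring
  · simp only [ha, hb, smul_add, smul_sub, smul_smul]
    match_scalars <;> field_simp <;> ring
  · intro t ht
    have h0 := ht.1
    have h1 := ht.2
    calc ‖x₀ + t • y₀ + t ^ 2 • a + t ^ 3 • b‖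
        ≤ ‖x₀‖ + t * ‖y₀‖ + t ^ 2 * ‖a‖ + t ^ 3 * ‖b‖ := by
          refine norm_add₄_le.trans_eq ?_
          simp only [norm_smul, norm_pow, Real.norm_of_nonneg h0]
      _ ≤ s + l * s + l ^ 2 * ((3 + 2 * l) / l ^ 2 * s) + l ^ 3 * ((2 + l) / l ^ 3 * s) := by
          gcongr
          · rw [hs]; linarith
          · rw [hs]; linarith
      _ = _ := by field_simp; ring
  · intro t ht
    have h0 := ht.1
    have h1 := ht.2
    calc ‖(2 : ℝ) • a + (6 * t) • b‖ ≤ 2 * ‖a‖ + 6 * t * ‖b‖ := by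
          refine (norm_add_le _ _).trans_eq ?_
          rw [norm_smul, norm_smul, Real.norm_of_nonneg (by positivity : 0 ≤ 6 * t),
            Real.norm_ofNat]
      _ ≤ 2 * ((3 + 2 * l) / l ^ 2 * s) + 6 * l * ((2 + l) / l ^ 3 * s) := by gcongr
      _ = _ := by field_simp; ring

end Hermite

/-! ### The differential expression on one edge: Green's formula, gauge and regularity -/

theorem IsH2Rep.prim {l : ℝ} {u : SegL2 l} {f f' f'' : ℝ → Spin} (h : IsH2Rep l u f f' f'') :
    IsPrimitive l f f' := ⟨h.int1, h.eq⟩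

theorem IsH2Rep.prim_deriv {l : ℝ} {u : SegL2 l} {f f' f'' : ℝ → Spin}
    (h : IsH2Rep l u f f' f'') : IsPrimitive l f' f'' := ⟨h.int2, h.deriv_eq⟩

namespace RashbaNetwork

variable {N : RashbaNetwork}

/-- `f` belongs to `H²` on the edge `e`, and the differential expression maps it to `h`. -/
structure IsEdgePair (e : N.edge) (f h : SegL2 (N.len e)) : Prop where
  isH2 : IsH2 _ f
  image : h =ᵐ[segMeasure (N.len e)] N.edgeExpr e (h2Val _ f) (h2D1 _ f) (h2D2 _ f)

/-- The covariant derivative of an element of `H²` on the edge `e`. -/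
def cov (e : N.edge) (f : SegL2 (N.len e)) : ℝ → Spin := N.covDeriv e (h2Val _ f) (h2D1 _ f)

theorem edgeExpr_congr (e : N.edge) {f f' f'' g g' g'' : ℝ → Spin} {t : ℝ} (h : f t = g t)
    (h' : f' t = g' t) (h'' : f'' t = g'' t) : N.edgeExpr e f f' f'' t = N.edgeExpr e g g' g'' t := by
  simp only [edgeExpr, momentum, momentumDeriv, h, h', h'']

theorem covDeriv_congr (e : N.edge) {f f' g g' : ℝ → Spin} {t : ℝ} (h : f t = g t)
    (h' : f' t = g' t) : N.covDeriv e f f' t = N.covDeriv e g g' t := by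
  simp only [covDeriv, h, h']

/-- The functions `h2Val`, `h2D1`, `h2D2` come from a choice. Uniqueness of representatives allows
the image to be checked on any explicit representative instead. -/
theorem _root_.IsH2Rep.isEdgePair {e : N.edge} {u h : SegL2 (N.len e)} {f f' f'' : ℝ → Spin}
    (hu : IsH2Rep _ u f f' f'') (hh : h =ᵐ[segMeasure (N.len e)] N.edgeExpr e f f' f'') :
    IsEdgePair e u h where
  isH2 := hu.isH2
  image := by
    obtain ⟨h1, h2, h3⟩ := hu.unique (N.len_pos e) hu.isH2.rep
    refine hh.trans ?_
    filter_upwards [h3, ae_restrict_mem measurableSet_Icc] with t ht hI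
    exact edgeExpr_congr e (h1 t hI) (h2 t hI) ht

theorem covDeriv_eq (e : N.edge) (f f' : ℝ → Spin) (t : ℝ) :
    N.covDeriv e f f' t = f' t - Complex.I • N.pot e t (f t) := rfl

theorem momentum_eq (e : N.edge) (f f' : ℝ → Spin) (t : ℝ) :
    N.momentum e f f' t = Complex.I • N.covDeriv e f f' t := by
  rw [covDeriv_eq, smul_sub, smul_smul, Complex.I_mul_I, neg_one_smul, sub_neg_eq_add, pot_apply,
    momentum, add_assoc]

theorem momentumDeriv_eq (e : N.edge) (f f' f'' : ℝ → Spin) (t : ℝ) :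
    N.momentumDeriv e f f' f'' t
      = Complex.I • f'' t + (((deriv (N.a e) t : ℝ) : ℂ) • f t + N.pot e t (f' t)) := by
  rw [momentumDeriv, pot_apply]
  abel

/-- Since the momentum is i times the covariant derivative, the latter has derivative -i times
`momentumDeriv`. This makes the covariant derivative a factor to which the product rule applies. -/
theorem isPrimitive_covDeriv {l : ℝ} (e : N.edge) {f f' f'' : ℝ → Spin} (h : IsPrimitive l f f')
    (h' : IsPrimitive l f' f'') :
    IsPrimitive l (N.covDeriv e f f') (fun t => -(Complex.I • N.momentumDeriv e f f' f'' t)) := by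
  have hI := (isPrimitive_pot e h).clm
    ((-Complex.I • (1 : Spin →L[ℂ] Spin)).restrictScalars ℝ)
  refine (h'.add hI).congr_ae (fun t _ => ?_) (Filter.Eventually.of_forall fun t => ?_)
  · rw [covDeriv_eq, sub_eq_add_neg, ← neg_smul]
    rfl
  · dsimp only
    rw [momentumDeriv_eq, smul_add, smul_smul, Complex.I_mul_I, neg_one_smul, neg_add, neg_neg,
      ← neg_smul]
    rfl

theorem edgeExpr_eq (e : N.edge) (f f' f'' : ℝ → Spin) (t : ℝ) :
    N.edgeExpr e f f' f'' t = Complex.I • N.momentumDeriv e f f' f'' t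
      + Complex.I • N.pot e t (N.covDeriv e f f' t) + ((N.U e t - N.kR ^ 2 : ℝ) : ℂ) • f t := by
  rw [edgeExpr, momentum, add_assoc (Complex.I • _), ← pot_apply, momentum_eq, map_smul]
  push_cast
  rw [sub_smul]
  abel

/-- The Lagrange identity on an edge. -/
theorem lagrange_identity (e : N.edge) (f f' f'' g g' g'' : ℝ → Spin) (t : ℝ) :
    (inner ℂ (f' t) (N.covDeriv e g g' t)
        + inner ℂ (f t) (-(Complex.I • N.momentumDeriv e g g' g'' t)))
      - (inner ℂ (-(Complex.I • N.momentumDeriv e f f' f'' t)) (g t)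
        + inner ℂ (N.covDeriv e f f' t) (g' t))
      = inner ℂ (N.edgeExpr e f f' f'' t) (g t) - inner ℂ (f t) (N.edgeExpr e g g' g'' t) := by
  have hf : f' t = N.covDeriv e f f' t + Complex.I • N.pot e t (f t) := by
    rw [covDeriv_eq, sub_add_cancel]
  have hg : g' t = N.covDeriv e g g' t + Complex.I • N.pot e t (g t) := by
    rw [covDeriv_eq, sub_add_cancel]
  have h1 : inner ℂ (f' t) (N.covDeriv e g g' t)
      = inner ℂ (N.covDeriv e f f' t) (N.covDeriv e g g' t)
        - Complex.I * inner ℂ (f t) (N.pot e t (N.covDeriv e g g' t)) := by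
    conv_lhs => rw [hf]
    rw [inner_add_left, inner_smul_left, Complex.conj_I, N.isSymmetric_pot]
    ring
  have h2 : inner ℂ (N.covDeriv e f f' t) (g' t)
      = inner ℂ (N.covDeriv e f f' t) (N.covDeriv e g g' t)
        + Complex.I * inner ℂ (N.pot e t (N.covDeriv e f f' t)) (g t) := by
    conv_lhs => rw [hg]
    rw [inner_add_right, inner_smul_right, N.isSymmetric_pot]
  rw [h1, h2, edgeExpr_eq, edgeExpr_eq]
  simp only [inner_add_left, inner_add_right, inner_smul_left, inner_smul_right, inner_neg_left,
    inner_neg_right, Complex.conj_I, Complex.conj_ofReal]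
  ring

/-- Green's formula on an edge. -/
theorem IsEdgePair.green {e : N.edge} {f h g k : SegL2 (N.len e)} (hf : IsEdgePair e f h)
    (hg : IsEdgePair e g k) :
    inner ℂ f k - inner ℂ h g
      = (inner ℂ (h2Val _ f 0) (cov e g 0) - inner ℂ (cov e f 0) (h2Val _ g 0))
        - (inner ℂ (h2Val _ f (N.len e)) (cov e g (N.len e))
          - inner ℂ (cov e f (N.len e)) (h2Val _ g (N.len e))) := by
  have rf := hf.isH2.rep
  have rg := hg.isH2.rep
  have h1 := (rf.prim.bilin innerBilin (isPrimitive_covDeriv e rg.prim rg.prim_deriv))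
  have h2 := ((isPrimitive_covDeriv e rf.prim rf.prim_deriv).bilin innerBilin rg.prim)
  have hl := (N.len_pos e).le
  have h3 : ∫ t, (inner ℂ (h t) (g t) - inner ℂ (f t) (k t)) ∂segMeasure (N.len e)
      = inner ℂ h g - inner ℂ f k := by
    rw [integral_sub (L2.integrable_inner h g) (L2.integrable_inner f k), L2.inner_def,
      L2.inner_def]
  rw [← neg_sub (inner ℂ h g), ← h3]
  have h4 := integral_sub h1.int h2.int
  rw [h1.integral_seg hl, h2.integral_seg hl] at h4
  rw [integral_congr_ae (g := fun t => inner ℂ (N.edgeExpr e (h2Val _ f) (h2D1 _ f) (h2D2 _ f) t)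
      (h2Val _ g t) - inner ℂ (h2Val _ f t) (N.edgeExpr e (h2Val _ g) (h2D1 _ g) (h2D2 _ g) t))]
  · simp only [← lagrange_identity]
    simp only [innerBilin_apply] at h4
    rw [h4]
    simp only [cov]
    ring
  · filter_upwards [hf.image, hg.image, rf.ae_eq, rg.ae_eq] with t e1 e2 e3 e4
    rw [e1, e2, e3, e4]

/-- The first derivative of `gauge e t (u t)`. -/
def gaugeD1 (e : N.edge) (u u' : ℝ → Spin) (t : ℝ) : Spin :=
  Complex.I • N.pot e t (N.gauge e t (u t)) + N.gauge e t (u' t)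

/-- The second derivative of `gauge e t (u t)`. -/
def gaugeD2 (e : N.edge) (u u' u'' : ℝ → Spin) (t : ℝ) : Spin :=
  Complex.I • (((deriv (N.a e) t : ℝ) : ℂ) • N.gauge e t (u t) + N.pot e t (gaugeD1 e u u' t))
    + (Complex.I • N.pot e t (N.gauge e t (u' t)) + N.gauge e t (u'' t))

theorem covDeriv_gauge (e : N.edge) (u u' : ℝ → Spin) (t : ℝ) :
    N.covDeriv e (fun t => N.gauge e t (u t)) (gaugeD1 e u u') t = N.gauge e t (u' t) := by
  rw [covDeriv_eq, gaugeD1, add_sub_cancel_left]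

/-- The gauge intertwines the covariant derivative with d/dt, and (i d/dt + a + k_R σ)² is minus the
square of the covariant derivative. The scalar terms commute with the gauge. -/
theorem edgeExpr_gauge (e : N.edge) (u u' u'' : ℝ → Spin) (t : ℝ) :
    N.edgeExpr e (fun t => N.gauge e t (u t)) (gaugeD1 e u u') (gaugeD2 e u u' u'') t
      = N.gauge e t (-u'' t + ((N.U e t - N.kR ^ 2 : ℝ) : ℂ) • u t) := by
  rw [edgeExpr_eq, covDeriv_gauge, momentumDeriv_eq, gaugeD2, map_add, map_neg, map_smul]
  simp only [smul_add, smul_smul, ← mul_assoc, Complex.I_mul_I]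
  rw [gaugeD1]
  module

theorem aestronglyMeasurable_gauge (e : N.edge) {μ : Measure ℝ} {f : ℝ → Spin}
    (hf : AEStronglyMeasurable f μ) : AEStronglyMeasurable (fun t => N.gauge e t (f t)) μ :=
  applyBilin.aestronglyMeasurable_comp₂ (N.continuous_gauge e).aestronglyMeasurable hf

theorem memLp_gauge (e : N.edge) {μ : Measure ℝ} {f : ℝ → Spin}
    (hf : MemLp f 2 μ) : MemLp (fun t => N.gauge e t (f t)) 2 μ :=
  hf.of_le (aestronglyMeasurable_gauge e hf.aestronglyMeasurable)
    (Filter.Eventually.of_forall fun t => (N.norm_gauge e t _).le)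

theorem memLp_gaugeInv (e : N.edge) {μ : Measure ℝ} {f : ℝ → Spin}
    (hf : MemLp f 2 μ) : MemLp (fun t => N.gaugeInv e t (f t)) 2 μ :=
  hf.of_le (applyBilin.aestronglyMeasurable_comp₂ (N.continuous_gaugeInv e).aestronglyMeasurable
    hf.aestronglyMeasurable) (Filter.Eventually.of_forall fun t => (N.norm_gaugeInv e t _).le)

theorem eLpNorm_gauge (e : N.edge) {μ : Measure ℝ} (f : ℝ → Spin) :
    eLpNorm (fun t => N.gauge e t (f t)) 2 μ = eLpNorm f 2 μ :=
  eLpNorm_congr_norm_ae (Filter.Eventually.of_forall fun t => N.norm_gauge e t _)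

theorem isH2Rep_gauge (e : N.edge) {f : SegL2 (N.len e)} {u u' u'' : ℝ → Spin}
    (h : IsPrimitive (N.len e) u u') (h' : IsPrimitive (N.len e) u' u'')
    (h'' : MemLp u'' 2 (segMeasure (N.len e)))
    (hf : f =ᵐ[segMeasure (N.len e)] fun t => N.gauge e t (u t)) :
    IsH2Rep (N.len e) f (fun t => N.gauge e t (u t)) (gaugeD1 e u u') (gaugeD2 e u u' u'') := by
  have p1 : IsPrimitive (N.len e) (fun t => N.gauge e t (u t)) (gaugeD1 e u u') :=
    isPrimitive_gauge e h
  have p2 : IsPrimitive (N.len e) (gaugeD1 e u u') (gaugeD2 e u u' u'') := by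
    refine (((isPrimitive_pot e p1).clm
      ((Complex.I • (1 : Spin →L[ℂ] Spin)).restrictScalars ℝ)).add
      (isPrimitive_gauge e h')).congr_ae (fun t _ => rfl)
      (Filter.Eventually.of_forall fun t => rfl)
  refine ⟨hf, ?_, p2.eq, p1.eq⟩
  have hpot : ∀ g : ℝ → Spin, ContinuousOn g (Icc 0 (N.len e)) →
      ContinuousOn (fun t => N.pot e t (g t)) (Icc 0 (N.len e)) := fun g hg =>
    (N.continuous_pot e).continuousOn.clm_apply hg
  have c1 : ContinuousOn (fun t => ((deriv (N.a e) t : ℝ) : ℂ) • N.gauge e t (u t))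
      (Icc 0 (N.len e)) :=
    (Complex.continuous_ofReal.comp (N.continuous_deriv_a e)).continuousOn.smul p1.continuousOn
  have c2 := hpot _ p2.continuousOn
  have c3 := hpot _ ((N.continuous_gauge e).continuousOn.clm_apply h'.continuousOn)
  have m1 := memLp_of_continuousOn ((c1.add c2).const_smul Complex.I)
  have m2 := memLp_of_continuousOn (c3.const_smul Complex.I)
  have m3 := (m1.add (m2.add (memLp_gauge e h'')))
  exact m3

theorem memLp_potential (e : N.edge) :
    MemLp (fun t => N.U e t - N.kR ^ 2) 2 (segMeasure (N.len e)) :=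
  (N.U_memLp e).sub (memLp_const _)

/-- Functions on an edge from functions in the gauge where the matrix potential vanishes. -/
theorem exists_isEdgePair_gauge (e : N.edge) {u u' u'' : ℝ → Spin}
    (h : IsPrimitive (N.len e) u u') (h' : IsPrimitive (N.len e) u' u'')
    (h'' : MemLp u'' 2 (segMeasure (N.len e))) :
    ∃ f k : SegL2 (N.len e), IsEdgePair e f k ∧
      (∀ t ∈ Icc 0 (N.len e), h2Val _ f t = N.gauge e t (u t)) ∧
      (∀ t ∈ Icc 0 (N.len e), cov e f t = N.gauge e t (u' t)) ∧
      f =ᵐ[segMeasure (N.len e)] (fun t => N.gauge e t (u t)) ∧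
      k =ᵐ[segMeasure (N.len e)]
        fun t => N.gauge e t (-u'' t + ((N.U e t - N.kR ^ 2 : ℝ) : ℂ) • u t) := by
  have m1 := memLp_gauge e (memLp_of_continuousOn h.continuousOn)
  have m2 := memLp_gauge e (h''.neg.add (memLp_smul_of_continuousOn (memLp_potential e)
    h.continuousOn))
  have hr := isH2Rep_gauge e h h' h'' m1.coeFn_toLp
  refine ⟨m1.toLp, m2.toLp, hr.isEdgePair ?_, fun t ht => ?_, fun t ht => ?_, m1.coeFn_toLp,
    m2.coeFn_toLp⟩
  · refine m2.coeFn_toLp.trans (Filter.Eventually.of_forall fun t => ?_)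
    exact (edgeExpr_gauge e u u' u'' t).symm
  · exact (hr.isH2.rep.unique (N.len_pos e) hr).1 t ht
  · rw [cov, ← covDeriv_gauge]
    exact covDeriv_congr e ((hr.isH2.rep.unique (N.len_pos e) hr).1 t ht)
      ((hr.isH2.rep.unique (N.len_pos e) hr).2.1 t ht)

/-- Weak solutions on an edge, tested with functions with vanishing boundary data, are in `H²`. -/
theorem isEdgePair_of_weak (e : N.edge) {g k : SegL2 (N.len e)}
    (H : ∀ f h : SegL2 (N.len e), IsEdgePair e f h → h2Val _ f 0 = 0 → h2Val _ f (N.len e) = 0 →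
      cov e f 0 = 0 → cov e f (N.len e) = 0 → inner ℂ f k = inner ℂ h g) :
    IsEdgePair e g k := by
  -- Pulled back by the inverse gauge, the weak equation for (g, k) becomes the one for -y'' + (U -
  -- k_R²) y. Test functions on the segment are pushed forward by the gauge, which preserves
  -- vanishing boundary data.
  obtain ⟨z, z', z'', hz, hz', hz'', h1, h2⟩ := exists_primitive_of_weak (N.len_pos e)
    (memLp_potential e) (memLp_gaugeInv e (Lp.memLp g)) (memLp_gaugeInv e (Lp.memLp k))
    fun u u' u'' hu hu' hu'' u0 ul u'0 u'l => by
      obtain ⟨f, h, hp, hv, hc, hf, hh⟩ := exists_isEdgePair_gauge e hu hu' hu''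
      have m0 := left_mem_Icc.2 (N.len_pos e).le
      have ml := right_mem_Icc.2 (N.len_pos e).le
      have := H f h hp (by rw [hv _ m0, u0, map_zero]) (by rw [hv _ ml, ul, map_zero])
        (by rw [hc _ m0, u'0, map_zero]) (by rw [hc _ ml, u'l, map_zero])
      rw [L2.inner_def, L2.inner_def] at this
      refine Eq.trans ?_ (this.trans ?_)
      · refine integral_congr_ae ?_
        filter_upwards [hf] with t ht
        rw [ht, inner_gauge_left]
      · refine integral_congr_ae ?_
        filter_upwards [hh] with t ht
        rw [ht, inner_gauge_left]
  have hg : g =ᵐ[segMeasure (N.len e)] fun t => N.gauge e t (z t) := by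
    filter_upwards [h1] with t ht
    rw [← ht, gauge_gaugeInv]
  refine (isH2Rep_gauge e hz hz' hz'' hg).isEdgePair ?_
  filter_upwards [h2] with t ht
  rw [edgeExpr_gauge, ← ht, gauge_gaugeInv]

end RashbaNetwork

/-! ### Extension and trace bounds that are uniform in the edge -/

theorem eLpNorm_seg_le_of_bound {E : Type*} [NormedAddCommGroup E] {l C B : ℝ} (hl : 0 ≤ l)
    (hC : l ≤ C) {f : ℝ → E} (hf : ∀ t ∈ Icc 0 l, ‖f t‖ ≤ B) :
    eLpNorm f 2 (segMeasure l) ≤ ENNReal.ofReal (√C * B) := by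
  refine (eLpNorm_le_of_ae_bound (C := B) ?_).trans ?_
  · filter_upwards [ae_restrict_mem measurableSet_Icc] with t ht using hf t ht
  · rw [ENNReal.ofReal_mul (Real.sqrt_nonneg _), Measure.restrict_apply_univ, Real.volume_Icc,
      sub_zero, Real.sqrt_eq_rpow, ← ENNReal.ofReal_rpow_of_nonneg (hl.trans hC) (by norm_num)]
    have : (2 : ℝ≥0∞).toReal⁻¹ = 1 / 2 := by norm_num
    rw [this]
    gcongr

namespace RashbaNetwork

variable (N : RashbaNetwork)

/-- Boundary data on an edge have extensions that are bounded uniformly in the edge. -/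
theorem exists_extension : ∃ K : ℝ, 0 ≤ K ∧ ∀ (e : N.edge) (x₀ x₁ y₀ y₁ : Spin),
    ∃ f k : SegL2 (N.len e), IsEdgePair e f k ∧ h2Val _ f 0 = x₀ ∧ h2Val _ f (N.len e) = x₁ ∧
      cov e f 0 = y₀ ∧ cov e f (N.len e) = y₁ ∧
      ‖f‖ ≤ K * (‖x₀‖ + ‖x₁‖ + ‖y₀‖ + ‖y₁‖) ∧ ‖k‖ ≤ K * (‖x₀‖ + ‖x₁‖ + ‖y₀‖ + ‖y₁‖) := by
  obtain ⟨c, hc, hlow⟩ := N.length_lower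
  obtain ⟨C₀, hup₀⟩ := N.length_upper
  -- Without edges the given upper bound could be negative.
  obtain ⟨C, hC0, hup⟩ : ∃ C : ℝ, 0 ≤ C ∧ ∀ e ∈ N.edge, dist e.1 e.2 ≤ C :=
    ⟨max C₀ 0, le_max_right _ _, fun e he => (hup₀ e he).trans (le_max_left _ _)⟩
  obtain ⟨M, hM⟩ := N.U_bound
  set B₁ := 6 + 4 * C with hB₁
  set B₂ := (18 + 10 * C) / c ^ 2 with hB₂
  set W := (M : ℝ) + √C * N.kR ^ 2 with hW
  have hB₁0 : 0 ≤ B₁ := by positivity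
  have hB₂0 : 0 ≤ B₂ := by positivity
  have hW0 : 0 ≤ W := by positivity
  -- B₁ and B₂ bound the interpolant and its second derivative in supremum norm, √C converts these
  -- into L² bounds, and W bounds the L² norm of U - k_R². The first summand serves f, the bracket
  -- its image.
  refine ⟨√C * B₁ + (√C * B₂ + B₁ * W), by positivity, fun e x₀ x₁ y₀ y₁ => ?_⟩
  have hl := N.len_pos e
  have hlc : c ≤ N.len e := hlow e.1 e.2
  have hlC : N.len e ≤ C := hup e.1 e.2
  -- The interpolation takes place in the gauge, so the data at the far end are pulled back first;
  -- this leaves their norms unchanged. At 0 the gauge is the identity.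
  obtain ⟨u, u', u'', hu, hu', hcu, u0, ul, u'0, u'l, b, b''⟩ := exists_hermite hl x₀
    (N.gaugeInv e (N.len e) x₁) y₀ (N.gaugeInv e (N.len e) y₁)
  rw [norm_gaugeInv, norm_gaugeInv] at b b''
  set s := ‖x₀‖ + ‖x₁‖ + ‖y₀‖ + ‖y₁‖ with hs
  have hs0 : 0 ≤ s := by positivity
  have b1 : ∀ t ∈ Icc 0 (N.len e), ‖u t‖ ≤ B₁ * s := fun t ht => (b t ht).trans (by
    rw [hB₁]; gcongr)
  have b2 : ∀ t ∈ Icc 0 (N.len e), ‖-u'' t‖ ≤ B₂ * s := fun t ht => by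
    rw [norm_neg]
    refine (b'' t ht).trans ?_
    rw [hB₂]
    gcongr
  obtain ⟨f, k, hp, hv, hcv, hf, hk⟩ := exists_isEdgePair_gauge e hu hu'
    (memLp_of_continuousOn hcu.continuousOn)
  have m0 := left_mem_Icc.2 hl.le
  have ml := right_mem_Icc.2 hl.le
  have hV : eLpNorm (fun t => N.U e t - N.kR ^ 2) 2 (segMeasure (N.len e))
      ≤ ENNReal.ofReal W := by
    refine (eLpNorm_sub_le (N.U_memLp e).aestronglyMeasurable aestronglyMeasurable_const
      (by norm_num)).trans ?_
    rw [hW, ENNReal.ofReal_add M.coe_nonneg (by positivity), ENNReal.ofReal_coe_nnreal]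
    refine add_le_add (hM e) (eLpNorm_seg_le_of_bound hl.le hlC fun t _ => ?_)
    rw [Real.norm_of_nonneg (by positivity)]
  refine ⟨f, k, hp, ?_, ?_, ?_, ?_, ?_, ?_⟩
  · rw [hv _ m0, u0, gauge_zero]; rfl
  · rw [hv _ ml, ul, gauge_gaugeInv]
  · rw [hcv _ m0, u'0, gauge_zero]; rfl
  · rw [hcv _ ml, u'l, gauge_gaugeInv]
  · rw [Lp.norm_def]
    refine ENNReal.toReal_le_of_le_ofReal (by positivity) ?_
    rw [eLpNorm_congr_ae hf, eLpNorm_gauge]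
    refine (eLpNorm_seg_le_of_bound hl.le hlC b1).trans
      (ENNReal.ofReal_le_ofReal ?_)
    rw [← mul_assoc]
    exact mul_le_mul_of_nonneg_right (le_add_of_nonneg_right (by positivity)) hs0
  · rw [Lp.norm_def]
    refine ENNReal.toReal_le_of_le_ofReal (by positivity) ?_
    rw [eLpNorm_congr_ae hk, eLpNorm_gauge]
    refine (eLpNorm_add_le (memLp_of_continuousOn hcu.neg.continuousOn).aestronglyMeasurable
      (memLp_smul_of_continuousOn (memLp_potential e) hu.continuousOn).aestronglyMeasurable
      (by norm_num)).trans ?_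
    refine (add_le_add (eLpNorm_seg_le_of_bound hl.le hlC b2)
      ((eLpNorm_smul_le_of_bound b1).trans (mul_le_mul_right hV _))).trans ?_
    rw [← ENNReal.ofReal_mul (by positivity), ← ENNReal.ofReal_add (by positivity) (by positivity)]
    refine ENNReal.ofReal_le_ofReal ?_
    have : 0 ≤ √C * B₁ * s := by positivity
    linarith

/-- The boundary data on an edge are bounded by the graph norm, uniformly in the edge. -/
theorem exists_trace_bound : ∃ K : ℝ, 0 ≤ K ∧ ∀ (e : N.edge) (g k : SegL2 (N.len e)),
    IsEdgePair e g k → ‖h2Val _ g 0‖ ≤ K * (‖g‖ + ‖k‖) ∧ ‖h2Val _ g (N.len e)‖ ≤ K * (‖g‖ + ‖k‖) ∧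
      ‖cov e g 0‖ ≤ K * (‖g‖ + ‖k‖) ∧ ‖cov e g (N.len e)‖ ≤ K * (‖g‖ + ‖k‖) := by
  obtain ⟨K, hK, hext⟩ := N.exists_extension
  refine ⟨K, hK, fun e g k hg => ?_⟩
  -- Duality: if Green's formula against an extension of the datum z produces ±‖z‖², Cauchy–Schwarz
  -- and division by ‖z‖ give the bound.
  have aux : ∀ (z : Spin) (f h : SegL2 (N.len e)), ‖f‖ ≤ K * ‖z‖ → ‖h‖ ≤ K * ‖z‖ →
      ‖inner ℂ f k - inner ℂ h g‖ = ‖inner ℂ z z‖ → ‖z‖ ≤ K * (‖g‖ + ‖k‖) := by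
    intro z f h hf hh he
    rcases (norm_nonneg z).eq_or_lt with hz | hz
    · rw [← hz]; positivity
    · refine le_of_mul_le_mul_left ?_ hz
      rw [← inner_self_eq_norm_mul_norm (𝕜 := ℂ), inner_self_re_eq_norm, ← he]
      calc ‖inner ℂ f k - inner ℂ h g‖ ≤ ‖f‖ * ‖k‖ + ‖h‖ * ‖g‖ :=
            (norm_sub_le _ _).trans (add_le_add (norm_inner_le_norm _ _) (norm_inner_le_norm _ _))
        _ ≤ K * ‖z‖ * ‖k‖ + K * ‖z‖ * ‖g‖ := by gcongr
        _ = ‖z‖ * (K * (‖g‖ + ‖k‖)) := by ring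
  refine ⟨?_, ?_, ?_, ?_⟩
  -- Green's formula pairs values with covariant derivatives, so a value of g is detected by placing
  -- it in the derivative slot of the test function, and conversely.
  · obtain ⟨f, h, hp, h1, h2, h3, h4, h5, h6⟩ := hext e 0 0 (h2Val _ g 0) 0
    refine aux _ f h (by simpa using h5) (by simpa using h6) ?_
    rw [hp.green hg, h1, h2, h3, h4]
    simp only [inner_zero_left, zero_sub, sub_zero, norm_neg]
  · obtain ⟨f, h, hp, h1, h2, h3, h4, h5, h6⟩ := hext e 0 0 0 (h2Val _ g (N.len e))
    refine aux _ f h (by simpa using h5) (by simpa using h6) ?_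
    rw [hp.green hg, h1, h2, h3, h4]
    simp only [inner_zero_left, zero_sub, sub_zero, norm_neg]
  · obtain ⟨f, h, hp, h1, h2, h3, h4, h5, h6⟩ := hext e (cov e g 0) 0 0 0
    refine aux _ f h (by simpa using h5) (by simpa using h6) ?_
    rw [hp.green hg, h1, h2, h3, h4]
    simp only [inner_zero_left, sub_zero]
  · obtain ⟨f, h, hp, h1, h2, h3, h4, h5, h6⟩ := hext e 0 (cov e g (N.len e)) 0 0
    refine aux _ f h (by simpa using h5) (by simpa using h6) ?_
    rw [hp.green hg, h1, h2, h3, h4]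
    simp only [inner_zero_left, zero_sub, sub_zero, norm_neg]

end RashbaNetwork

/-! ### Summability along maps with finite fibres -/

section Fiber

variable {ι κ : Type*} {p : ι → κ}

theorem memℓp_two_iff {E : ι → Type*} [∀ i, NormedAddCommGroup (E i)] {f : ∀ i, E i} :
    Memℓp f 2 ↔ Summable fun i => ‖f i‖ ^ 2 := by
  rw [memℓp_gen_iff (by norm_num)]
  simp

/-- With `p` the initial or terminal node, this turns a sum over edges into a sum over nodes. -/
theorem HasSum.fiber {E : Type*} [NormedAddCommGroup E] {F : ι → E} {a : E} (h : HasSum F a)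
    (hp : ∀ v, {i | p i = v}.Finite) : HasSum (fun v => ∑ i ∈ (hp v).toFinset, F i) a := by
  have h1 := (Equiv.sigmaFiberEquiv p).hasSum_iff.2 h
  refine h1.sigma fun v => ?_
  have : Fintype {i // p i = v} := (hp v).fintype
  rw [Finset.sum_subtype (hp v).toFinset (p := fun i => p i = v) (by simp)]
  exact hasSum_fintype _

/-- Cauchy–Schwarz on each fibre costs at most the factor M. -/
theorem summable_sq_fiber_sum (hp : ∀ v, {i | p i = v}.Finite) {M : ℕ}
    (hM : ∀ v, (hp v).toFinset.card ≤ M) {X : ι → ℝ} (hX : Summable fun i => X i ^ 2) :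
    Summable fun v => (∑ i ∈ (hp v).toFinset, X i) ^ 2 := by
  refine Summable.of_nonneg_of_le (fun v => sq_nonneg _) (fun v => ?_)
    ((hX.hasSum.fiber hp).summable.mul_left (M : ℝ))
  refine sq_sum_le_card_mul_sum_sq.trans ?_
  exact mul_le_mul_of_nonneg_right (by exact_mod_cast hM v)
    (Finset.sum_nonneg fun i _ => sq_nonneg _)

/-- Each Y v is repeated at most M times. -/
theorem summable_comp_fiber (hp : ∀ v, {i | p i = v}.Finite) {M : ℕ}
    (hM : ∀ v, (hp v).toFinset.card ≤ M) {Y : κ → ℝ} (hY0 : ∀ v, 0 ≤ Y v) (hY : Summable Y) :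
    Summable fun i => Y (p i) := by
  refine (Equiv.sigmaFiberEquiv p).summable_iff.1 ?_
  refine (summable_sigma_of_nonneg fun _ => hY0 _).2 ⟨fun v => ?_, ?_⟩
  · have : Finite {i // p i = v} := (hp v).to_subtype
    exact Summable.of_finite
  · refine Summable.of_nonneg_of_le (fun v => tsum_nonneg fun _ => hY0 _) (fun v => ?_)
      (hY.mul_left (M : ℝ))
    have : Fintype {i // p i = v} := (hp v).fintype
    rw [tsum_fintype]
    have h1 : ∑ b : {i // p i = v}, Y (p (Equiv.sigmaFiberEquiv p ⟨v, b⟩))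
        = ∑ i ∈ (hp v).toFinset, Y v := by
      rw [Finset.sum_subtype (hp v).toFinset (p := fun i => p i = v) (by simp)]
      refine Finset.sum_congr rfl fun b _ => ?_
      simp [b.2]
    rw [h1, Finset.sum_const, nsmul_eq_mul]
    exact mul_le_mul_of_nonneg_right (by exact_mod_cast hM v) (hY0 v)

theorem summable_sq_add {X Y : ι → ℝ} (hX : Summable fun i => X i ^ 2)
    (hY : Summable fun i => Y i ^ 2) : Summable fun i => (X i + Y i) ^ 2 := by
  refine Summable.of_nonneg_of_le (fun i => sq_nonneg _) (fun i => ?_)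
    ((hX.mul_left 2).add (hY.mul_left 2))
  nlinarith [sq_nonneg (X i - Y i)]

end Fiber

/-! ### The boundary maps of the network: square summability, Green's identity, surjectivity -/

namespace RashbaNetwork

variable (N : RashbaNetwork)

/-- The edges that start at a node. -/
def outEdges (v : N.vert) : Finset N.edge := (finite_src v).toFinset

/-- The edges that end at a node. -/
def inEdges (v : N.vert) : Finset N.edge := (finite_tgt v).toFinset

/-- The degree of a node. -/
def degree (v : N.vert) : ℕ := (N.outEdges v).card + (N.inEdges v).card

variable {N}

@[simp] theorem mem_outEdges {v : N.vert} {e : N.edge} : e ∈ N.outEdges v ↔ N.src e = v := by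
  simp [outEdges]

@[simp] theorem mem_inEdges {v : N.vert} {e : N.edge} : e ∈ N.inEdges v ↔ N.tgt e = v := by
  simp [inEdges]

theorem exists_edge (v : N.vert) : (∃ e, N.src e = v) ∨ ∃ e, N.tgt e = v := by
  obtain ⟨M, hM⟩ := N.degree_bound
  have h1 := (hM v v.2).1
  by_cases hin : {w | (w, v.1) ∈ N.edge} = ∅
  · have hout : {w | (v.1, w) ∈ N.edge}.encard ≠ 0 := by
      intro h0
      rw [hin, h0] at h1
      simp at h1
    obtain ⟨w, hw⟩ := Set.encard_ne_zero.1 hout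
    exact Or.inl ⟨⟨(v.1, w), hw⟩, rfl⟩
  · obtain ⟨w, hw⟩ := Set.nonempty_iff_ne_empty.2 hin
    exact Or.inr ⟨⟨(w, v.1), hw⟩, rfl⟩

theorem degree_pos (v : N.vert) : 0 < N.degree v := by
  rcases exists_edge v with ⟨e, he⟩ | ⟨e, he⟩
  · exact Nat.add_pos_left (Finset.card_pos.2 ⟨e, mem_outEdges.2 he⟩) _
  · exact Nat.add_pos_right _ (Finset.card_pos.2 ⟨e, mem_inEdges.2 he⟩)

variable (N)

theorem exists_card_bound :
    ∃ M : ℕ, (∀ v, (N.outEdges v).card ≤ M) ∧ ∀ v, (N.inEdges v).card ≤ M := by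
  obtain ⟨M, hM⟩ := N.degree_bound
  refine ⟨M, fun v => ?_, fun v => ?_⟩
  · have h1 : ((N.outEdges v : Set N.edge)).encard ≤ {w | (v.1, w) ∈ N.edge}.encard := by
      refine Set.encard_le_encard_of_injOn (f := fun e : N.edge => e.1.2) ?_ ?_
      · intro e he
        obtain rfl := mem_outEdges.1 (Finset.mem_coe.1 he)
        exact e.2
      · intro e he e' he' h
        have h1 := mem_outEdges.1 (Finset.mem_coe.1 he)
        have h2 := mem_outEdges.1 (Finset.mem_coe.1 he')
        exact Subtype.ext (Prod.ext (congrArg Subtype.val (h1.trans h2.symm)) h)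
    have h2 := h1.trans (le_add_self.trans (hM v v.2).2)
    rw [Set.encard_coe_eq_coe_finsetCard] at h2
    exact_mod_cast h2
  · have h1 : ((N.inEdges v : Set N.edge)).encard ≤ {w | (w, v.1) ∈ N.edge}.encard := by
      refine Set.encard_le_encard_of_injOn (f := fun e : N.edge => e.1.1) ?_ ?_
      · intro e he
        obtain rfl := mem_inEdges.1 (Finset.mem_coe.1 he)
        exact e.2
      · intro e he e' he' h
        have h1 := mem_inEdges.1 (Finset.mem_coe.1 he)
        have h2 := mem_inEdges.1 (Finset.mem_coe.1 he')
        exact Subtype.ext (Prod.ext h (congrArg Subtype.val (h1.trans h2.symm)))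
    have h2 := h1.trans (le_self_add.trans (hM v v.2).2)
    rw [Set.encard_coe_eq_coe_finsetCard] at h2
    exact_mod_cast h2

variable {N}

theorem isEdgePair_maxOp (f : N.dom) (e : N.edge) :
    IsEdgePair e ((f : N.StateSpace) e) (N.maxOp f e) :=
  ⟨f.2.isH2 e, N.maxOp_spec f e⟩

theorem memDomain_of_isEdgePair {f h : N.StateSpace} (hp : ∀ e, IsEdgePair e (f e) (h e))
    {φ : N.vert → Spin} (hφ : N.IsNodeValues f φ) : N.MemDomain f :=
  ⟨fun e => (hp e).isH2, ⟨h, fun e => (hp e).image⟩, ⟨φ, hφ⟩⟩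

theorem maxOp_eq_of_isEdgePair {f : N.dom} {h : N.StateSpace}
    (hp : ∀ e, IsEdgePair e ((f : N.StateSpace) e) (h e)) : N.maxOp f = h :=
  state_ext (fun e => N.maxOp_spec f e) fun e => (hp e).image

theorem nodeVal_eq {f : N.dom} {φ : N.vert → Spin} (hφ : N.IsNodeValues f φ) :
    N.nodeVal f = φ := (N.nodeVal_spec f).unique hφ

theorem nodeDeriv_apply (f : N.dom) (v : N.vert) :
    N.nodeDeriv f v = ∑ e ∈ N.outEdges v, cov e ((f : N.StateSpace) e) 0
      - ∑ e ∈ N.inEdges v, cov e ((f : N.StateSpace) e) (N.len e) := by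
  refine congrArg₂ (fun x y : Spin => x - y) ?_ ?_
  · exact finsum_mem_eq_finite_toFinset_sum _ (finite_src v)
  · exact finsum_mem_eq_finite_toFinset_sum _ (finite_tgt v)

/-- The boundary data of an element of the domain are dominated by a square summable family. -/
theorem exists_summable_bound (f : N.dom) : ∃ X : N.edge → ℝ, (Summable fun e => X e ^ 2) ∧
    ∀ e, ‖h2Val _ ((f : N.StateSpace) e) 0‖ ≤ X e ∧
      ‖h2Val _ ((f : N.StateSpace) e) (N.len e)‖ ≤ X e ∧
      ‖cov e ((f : N.StateSpace) e) 0‖ ≤ X e ∧ ‖cov e ((f : N.StateSpace) e) (N.len e)‖ ≤ X e := by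
  obtain ⟨K, hK, h⟩ := N.exists_trace_bound
  refine ⟨fun e => K * (‖(f : N.StateSpace) e‖ + ‖N.maxOp f e‖), ?_,
    fun e => h e _ _ (isEdgePair_maxOp f e)⟩
  simp only [mul_pow]
  exact (summable_sq_add (memℓp_two_iff.1 (lp.memℓp (f : N.StateSpace)))
    (memℓp_two_iff.1 (lp.memℓp (N.maxOp f)))).mul_left _

/-- A node value is the end value of some adjacent edge, and a node derivative is a sum of boundary
data of adjacent edges. Both are dominated by the sum of the trace bounds over these edges, which is
square summable because degrees are bounded. -/
theorem memℓp_node (f : N.dom) : Memℓp (N.nodeVal f) 2 ∧ Memℓp (N.nodeDeriv f) 2 := by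
  obtain ⟨X, hX, hb⟩ := exists_summable_bound f
  have hX0 : ∀ e, 0 ≤ X e := fun e => (norm_nonneg _).trans (hb e).1
  obtain ⟨M, hM1, hM2⟩ := N.exists_card_bound
  have hY := summable_sq_add (summable_sq_fiber_sum finite_src hM1 hX)
    (summable_sq_fiber_sum finite_tgt hM2 hX)
  have hdom : ∀ φ : N.vert → Spin, (∀ v, ‖φ v‖ ≤ ∑ e ∈ N.outEdges v, X e
      + ∑ e ∈ N.inEdges v, X e) → Memℓp φ 2 := fun φ h =>
    memℓp_two_iff.2 (Summable.of_nonneg_of_le (fun v => sq_nonneg _)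
      (fun v => pow_le_pow_left₀ (norm_nonneg _) (h v) 2) hY)
  have hS0 : ∀ s : Finset N.edge, 0 ≤ ∑ e ∈ s, X e := fun s => Finset.sum_nonneg fun e _ => hX0 e
  refine ⟨hdom _ fun v => ?_, hdom _ fun v => ?_⟩
  · rcases exists_edge v with ⟨e, rfl⟩ | ⟨e, rfl⟩
    · rw [← (N.nodeVal_spec f e).1]
      exact (hb e).1.trans ((Finset.single_le_sum (fun e _ => hX0 e)
        (mem_outEdges.2 rfl)).trans (le_add_of_nonneg_right (hS0 _)))
    · rw [← (N.nodeVal_spec f e).2]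
      exact (hb e).2.1.trans ((Finset.single_le_sum (fun e _ => hX0 e)
        (mem_inEdges.2 rfl)).trans (le_add_of_nonneg_left (hS0 _)))
  · rw [nodeDeriv_apply]
    exact (norm_sub_le _ _).trans (add_le_add
      (norm_sum_le_of_le _ fun e _ => (hb e).2.2.1) (norm_sum_le_of_le _ fun e _ => (hb e).2.2.2))

variable (N)

/-- The map `Γ` of node values. -/
def nodeValL2 : N.maxOp.domain →ₗ[ℂ] N.NodeSpace where
  toFun f := ⟨N.nodeVal f, (memℓp_node f).1⟩
  map_add' f g := Subtype.ext (N.nodeVal.map_add f g)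
  map_smul' c f := Subtype.ext (N.nodeVal.map_smul c f)

/-- The map `Γ'` of node derivatives. -/
def nodeDerivL2 : N.maxOp.domain →ₗ[ℂ] N.NodeSpace where
  toFun f := ⟨N.nodeDeriv f, (memℓp_node f).2⟩
  map_add' f g := Subtype.ext (N.nodeDeriv.map_add f g)
  map_smul' c f := Subtype.ext (N.nodeDeriv.map_smul c f)

variable {N}

/-- The boundary form of two elements of the domain at a point of an edge. -/
def boundaryForm (f g : N.StateSpace) (e : N.edge) (t : ℝ) : ℂ :=
  inner ℂ (h2Val _ (f e) t) (cov e (g e) t) - inner ℂ (cov e (f e) t) (h2Val _ (g e) t)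

theorem sum_boundaryForm (f g : N.dom) (v : N.vert) :
    ∑ e ∈ N.outEdges v, boundaryForm (f : N.StateSpace) g e 0
      - ∑ e ∈ N.inEdges v, boundaryForm (f : N.StateSpace) g e (N.len e)
      = inner ℂ (N.nodeVal f v) (N.nodeDeriv g v)
        - inner ℂ (N.nodeDeriv f v) (N.nodeVal g v) := by
  have eA : ∑ e ∈ N.outEdges v, boundaryForm (f : N.StateSpace) g e 0
      = inner ℂ (N.nodeVal f v) (∑ e ∈ N.outEdges v, cov e ((g : N.StateSpace) e) 0)
        - inner ℂ (∑ e ∈ N.outEdges v, cov e ((f : N.StateSpace) e) 0) (N.nodeVal g v) := by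
    rw [inner_sum, sum_inner, ← Finset.sum_sub_distrib]
    refine Finset.sum_congr rfl fun e he => ?_
    obtain rfl := mem_outEdges.1 he
    rw [boundaryForm, (N.nodeVal_spec f e).1, (N.nodeVal_spec g e).1]
  have eB : ∑ e ∈ N.inEdges v, boundaryForm (f : N.StateSpace) g e (N.len e)
      = inner ℂ (N.nodeVal f v) (∑ e ∈ N.inEdges v, cov e ((g : N.StateSpace) e) (N.len e))
        - inner ℂ (∑ e ∈ N.inEdges v, cov e ((f : N.StateSpace) e) (N.len e))
          (N.nodeVal g v) := by
    rw [inner_sum, sum_inner, ← Finset.sum_sub_distrib]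
    refine Finset.sum_congr rfl fun e he => ?_
    obtain rfl := mem_inEdges.1 he
    rw [boundaryForm, (N.nodeVal_spec f e).2, (N.nodeVal_spec g e).2]
  have key : ∀ x y a a' b b' : Spin, (inner ℂ x a' - inner ℂ a y) - (inner ℂ x b' - inner ℂ b y)
      = inner ℂ x (a' - b') - inner ℂ (a - b) y := fun x y a a' b b' => by
    rw [inner_sub_left, inner_sub_right]
    ring
  rw [eA, eB, key]
  exact congrArg₂ (fun p q : Spin => inner ℂ (N.nodeVal f v) p - inner ℂ q (N.nodeVal g v))
    (nodeDeriv_apply g v).symm (nodeDeriv_apply f v).symm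

/-- The two ends of an edge belong to different groups when the terms are collected by nodes, so the
families at the initial and at the terminal ends must be summable separately. -/
theorem summable_boundaryForm (f g : N.dom) :
    (Summable fun e => boundaryForm (f : N.StateSpace) g e 0) ∧
      Summable fun e => boundaryForm (f : N.StateSpace) g e (N.len e) := by
  obtain ⟨X, hX, hXb⟩ := exists_summable_bound f
  obtain ⟨Y, hY, hYb⟩ := exists_summable_bound g
  have bound : ∀ e t, ‖h2Val _ ((f : N.StateSpace) e) t‖ ≤ X e →
      ‖cov e ((f : N.StateSpace) e) t‖ ≤ X e → ‖h2Val _ ((g : N.StateSpace) e) t‖ ≤ Y e →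
      ‖cov e ((g : N.StateSpace) e) t‖ ≤ Y e →
      ‖boundaryForm (f : N.StateSpace) g e t‖ ≤ X e ^ 2 + Y e ^ 2 := by
    intro e t hx hx' hy hy'
    have hx0 : 0 ≤ X e := (norm_nonneg _).trans hx
    refine (norm_sub_le _ _).trans ((add_le_add (norm_inner_le_norm _ _)
      (norm_inner_le_norm _ _)).trans ?_)
    have h1 := mul_le_mul hx hy' (norm_nonneg _) hx0
    have h2 := mul_le_mul hx' hy (norm_nonneg _) hx0
    nlinarith [sq_nonneg (X e - Y e)]
  exact ⟨Summable.of_norm_bounded (hX.add hY) fun e =>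
      bound e 0 (hXb e).1 (hXb e).2.2.1 (hYb e).1 (hYb e).2.2.1,
    Summable.of_norm_bounded (hX.add hY) fun e =>
      bound e (N.len e) (hXb e).2.1 (hXb e).2.2.2 (hYb e).2.1 (hYb e).2.2.2⟩

/-- Green's formula for the network. -/
theorem green_maxOp (f g : N.maxOp.domain) :
    inner ℂ (f : N.StateSpace) (N.maxOp g) - inner ℂ (N.maxOp f) (g : N.StateSpace)
      = inner ℂ (N.nodeValL2 f) (N.nodeDerivL2 g) - inner ℂ (N.nodeDerivL2 f) (N.nodeValL2 g) := by
  obtain ⟨sA, sB⟩ := summable_boundaryForm (N := N) f g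
  have h1 : HasSum (fun e => boundaryForm (f : N.StateSpace) g e 0
      - boundaryForm (f : N.StateSpace) g e (N.len e))
      (inner ℂ (f : N.StateSpace) (N.maxOp g) - inner ℂ (N.maxOp f) (g : N.StateSpace)) :=
    ((lp.hasSum_inner (𝕜 := ℂ) (f : N.StateSpace) (N.maxOp g)).sub
      (lp.hasSum_inner (𝕜 := ℂ) (N.maxOp f) (g : N.StateSpace))).congr_fun fun e =>
        ((isEdgePair_maxOp f e).green (isEdgePair_maxOp g e)).symm
  -- Terms at 0 are grouped by initial node, terms at the far end by terminal node.
  have h3 : HasSum (fun v => inner ℂ (N.nodeVal f v) (N.nodeDeriv g v)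
        - inner ℂ (N.nodeDeriv f v) (N.nodeVal g v)) (∑' e, boundaryForm (f : N.StateSpace) g e 0
      - ∑' e, boundaryForm (f : N.StateSpace) g e (N.len e)) :=
    ((sA.hasSum.fiber finite_src).sub (sB.hasSum.fiber finite_tgt)).congr_fun
      fun v => (sum_boundaryForm (N := N) f g v).symm
  have h4 := (lp.hasSum_inner (𝕜 := ℂ) (N.nodeValL2 f) (N.nodeDerivL2 g)).sub
    (lp.hasSum_inner (𝕜 := ℂ) (N.nodeDerivL2 f) (N.nodeValL2 g))
  exact (h1.unique (sA.hasSum.sub sB.hasSum)).trans (h3.unique h4)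

/-- Node values and node derivatives can be prescribed. -/
theorem exists_boundary_values (φ ψ : N.NodeSpace) :
    ∃ f : N.maxOp.domain, N.nodeValL2 f = φ ∧ N.nodeDerivL2 f = ψ := by
  obtain ⟨K, hK, hext⟩ := N.exists_extension
  obtain ⟨M, hM1, hM2⟩ := N.exists_card_bound
  -- The prescribed node derivative is shared equally among all adjacent edges. Terminal ends enter
  -- the node derivative with a minus sign, hence -χ there below.
  set χ : N.vert → Spin := fun v => ((N.degree v : ℂ)⁻¹) • ψ v with hχ
  have hχn : ∀ v, ‖χ v‖ ≤ ‖ψ v‖ := fun v => by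
    rw [hχ, norm_smul, norm_inv, Complex.norm_natCast]
    refine mul_le_of_le_one_left (norm_nonneg _) (inv_le_one_of_one_le₀ ?_)
    exact_mod_cast degree_pos v
  choose F H hp h1 h2 h3 h4 h5 h6 using fun e : N.edge =>
    hext e (φ (N.src e)) (φ (N.tgt e)) (χ (N.src e)) (-χ (N.tgt e))
  have sφ := memℓp_two_iff.1 (lp.memℓp φ)
  have sχ : Summable fun v => ‖χ v‖ ^ 2 :=
    Summable.of_nonneg_of_le (fun v => sq_nonneg _)
      (fun v => pow_le_pow_left₀ (norm_nonneg _) (hχn v) 2) (memℓp_two_iff.1 (lp.memℓp ψ))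
  have hs : Summable fun e => (K * (‖φ (N.src e)‖ + ‖φ (N.tgt e)‖ + ‖χ (N.src e)‖
      + ‖-χ (N.tgt e)‖)) ^ 2 := by
    simp only [mul_pow, norm_neg]
    refine Summable.mul_left _ (summable_sq_add (summable_sq_add (summable_sq_add ?_ ?_) ?_) ?_)
    · exact summable_comp_fiber (p := N.src) (Y := fun v => ‖φ v‖ ^ 2) finite_src hM1
        (fun v => sq_nonneg _) sφ
    · exact summable_comp_fiber (p := N.tgt) (Y := fun v => ‖φ v‖ ^ 2) finite_tgt hM2
        (fun v => sq_nonneg _) sφ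
    · exact summable_comp_fiber (p := N.src) (Y := fun v => ‖χ v‖ ^ 2) finite_src hM1
        (fun v => sq_nonneg _) sχ
    · exact summable_comp_fiber (p := N.tgt) (Y := fun v => ‖χ v‖ ^ 2) finite_tgt hM2
        (fun v => sq_nonneg _) sχ
  have mF : Memℓp F 2 := memℓp_two_iff.2 (Summable.of_nonneg_of_le (fun e => sq_nonneg _)
    (fun e => pow_le_pow_left₀ (norm_nonneg _) (h5 e) 2) hs)
  have mH : Memℓp H 2 := memℓp_two_iff.2 (Summable.of_nonneg_of_le (fun e => sq_nonneg _)
    (fun e => pow_le_pow_left₀ (norm_nonneg _) (h6 e) 2) hs)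
  have hφ : N.IsNodeValues (⟨F, mF⟩ : N.StateSpace) φ := fun e => ⟨h1 e, h2 e⟩
  set f : N.dom := ⟨⟨F, mF⟩, memDomain_of_isEdgePair (h := ⟨H, mH⟩) hp hφ⟩ with hf
  refine ⟨f, ?_, ?_⟩
  · exact Subtype.ext (nodeVal_eq (f := f) hφ)
  · ext1
    funext v
    change N.nodeDeriv f v = ψ v
    rw [nodeDeriv_apply]
    have e1 : ∑ e ∈ N.outEdges v, cov e ((f : N.StateSpace) e) 0
        = ((N.outEdges v).card : ℂ) • χ v := by
      rw [Nat.cast_smul_eq_nsmul, ← Finset.sum_const]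
      refine Finset.sum_congr rfl fun e he => ?_
      obtain rfl := mem_outEdges.1 he
      exact h3 e
    have e2 : ∑ e ∈ N.inEdges v, cov e ((f : N.StateSpace) e) (N.len e)
        = -(((N.inEdges v).card : ℂ) • χ v) := by
      rw [Nat.cast_smul_eq_nsmul, ← smul_neg, ← Finset.sum_const]
      refine Finset.sum_congr rfl fun e he => ?_
      obtain rfl := mem_inEdges.1 he
      exact h4 e
    have hd : (N.degree v : ℂ) ≠ 0 := by exact_mod_cast (degree_pos v).ne'
    rw [e1, e2, sub_neg_eq_add, ← add_smul, ← Nat.cast_add]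
    change (N.degree v : ℂ) • χ v = ψ v
    rw [hχ, smul_smul, mul_inv_cancel₀ hd, one_smul]

end RashbaNetwork

/-! ### Weak characterisation of Π, closedness, and self-adjointness of the Hamiltonian -/

namespace RashbaNetwork

variable {N : RashbaNetwork}

theorem isEdgePair_zero (e : N.edge) : IsEdgePair e 0 0 :=
  (IsH2Rep.zero (N.len e)).isEdgePair ((Lp.coeFn_zero _ _ _).trans
    (Filter.Eventually.of_forall fun t => by
      simp [edgeExpr, momentum, momentumDeriv]))

theorem h2Val_zero (e : N.edge) {t : ℝ} (ht : t ∈ Icc 0 (N.len e)) :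
    h2Val (N.len e) 0 t = 0 :=
  ((IsH2Rep.zero (N.len e)).isH2.rep.unique (N.len_pos e) (IsH2Rep.zero _)).1 t ht

theorem cov_zero (e : N.edge) {t : ℝ} (ht : t ∈ Icc 0 (N.len e)) :
    cov e (0 : SegL2 (N.len e)) t = 0 := by
  obtain ⟨h1, h2, -⟩ := (IsH2Rep.zero (N.len e)).isH2.rep.unique (N.len_pos e) (IsH2Rep.zero _)
  exact (covDeriv_congr e (h1 t ht) (h2 t ht)).trans (by simp [covDeriv])

theorem left_mem_seg (e : N.edge) : (0 : ℝ) ∈ Icc 0 (N.len e) := left_mem_Icc.2 (N.len_pos e).le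

theorem right_mem_seg (e : N.edge) : N.len e ∈ Icc 0 (N.len e) := right_mem_Icc.2 (N.len_pos e).le

open Classical in
/-- A function on one edge with zero values at the end points belongs to the domain. -/
theorem exists_single {e : N.edge} {f h : SegL2 (N.len e)} (hp : IsEdgePair e f h)
    (h0 : h2Val _ f 0 = 0) (hl : h2Val _ f (N.len e) = 0) :
    ∃ F : N.dom, (F : N.StateSpace) = lp.single 2 e f ∧ N.maxOp F = lp.single 2 e h ∧
      N.nodeVal F = 0 ∧ N.nodeDeriv F
        = Pi.single (N.src e) (cov e f 0) - Pi.single (N.tgt e) (cov e f (N.len e)) := by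
  have hpair : ∀ e', IsEdgePair e' ((lp.single 2 e f : N.StateSpace) e')
      ((lp.single 2 e h : N.StateSpace) e') := fun e' => by
    by_cases he : e' = e
    · subst he
      rwa [lp.single_apply_self, lp.single_apply_self]
    · rw [lp.single_apply_ne _ _ _ he, lp.single_apply_ne _ _ _ he]
      exact isEdgePair_zero e'
  have hval : N.IsNodeValues (lp.single 2 e f : N.StateSpace) 0 := fun e' => by
    by_cases he : e' = e
    · subst he
      rw [lp.single_apply_self]
      exact ⟨h0, hl⟩
    · rw [lp.single_apply_ne _ _ _ he]
      exact ⟨h2Val_zero e' (left_mem_seg e'), h2Val_zero e' (right_mem_seg e')⟩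
  refine ⟨⟨lp.single 2 e f, memDomain_of_isEdgePair hpair hval⟩, rfl,
    maxOp_eq_of_isEdgePair hpair, nodeVal_eq hval, ?_⟩
  funext v
  rw [nodeDeriv_apply]
  have hne : ∀ e' t, e' ≠ e → t ∈ Icc 0 (N.len e') →
      cov e' ((lp.single 2 e f : N.StateSpace) e') t = 0 := fun e' t he ht => by
    rw [lp.single_apply_ne _ _ _ he]
    exact cov_zero e' ht
  have hself : ∀ t, cov e ((lp.single 2 e f : N.StateSpace) e) t = cov e f t := fun t => by
    rw [lp.single_apply_self]
  refine congrArg₂ (fun x y : Spin => x - y) ?_ ?_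
  · by_cases hv : N.src e = v
    · subst hv
      rw [Pi.single_eq_same, ← hself]
      exact Finset.sum_eq_single_of_mem e (mem_outEdges.2 rfl)
        fun e' _ he => hne e' 0 he (left_mem_seg e')
    · rw [Pi.single_eq_of_ne' hv]
      exact Finset.sum_eq_zero fun e' he => hne e' 0
        (fun h => hv (h ▸ mem_outEdges.1 he)) (left_mem_seg e')
  · by_cases hv : N.tgt e = v
    · subst hv
      rw [Pi.single_eq_same, ← hself]
      exact Finset.sum_eq_single_of_mem e (mem_inEdges.2 rfl)
        fun e' _ he => hne e' (N.len e') he (right_mem_seg e')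
    · rw [Pi.single_eq_of_ne' hv]
      exact Finset.sum_eq_zero fun e' he => hne e' (N.len e')
        (fun h => hv (h ▸ mem_inEdges.1 he)) (right_mem_seg e')

/-- `z` is the value of `g` at the node `v` along some edge. -/
def IsEndValue (g : N.StateSpace) (v : N.vert) (z : Spin) : Prop :=
  (∃ e, N.src e = v ∧ h2Val _ (g e) 0 = z) ∨ ∃ e, N.tgt e = v ∧ h2Val _ (g e) (N.len e) = z

theorem exists_isEndValue (g : N.StateSpace) (v : N.vert) : ∃ z, IsEndValue g v z := by
  rcases exists_edge v with ⟨e, he⟩ | ⟨e, he⟩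
  · exact ⟨_, Or.inl ⟨e, he, rfl⟩⟩
  · exact ⟨_, Or.inr ⟨e, he, rfl⟩⟩

open Classical in
/-- Test functions that are supported on one edge and read off an end value. -/
theorem IsEndValue.exists_test {g k : N.StateSpace} (hp : ∀ e, IsEdgePair e (g e) (k e))
    {v : N.vert} {z : Spin} (hz : IsEndValue g v z) (w : Spin) :
    ∃ F : N.dom, N.nodeVal F = 0 ∧ N.nodeDeriv F = Pi.single v w ∧
      inner ℂ (F : N.StateSpace) k - inner ℂ (N.maxOp F) g = -inner ℂ w z := by
  obtain ⟨K, -, hext⟩ := N.exists_extension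
  rcases hz with ⟨e, rfl, rfl⟩ | ⟨e, rfl, rfl⟩
  · obtain ⟨f, h, hf, h1, h2, h3, h4, -, -⟩ := hext e 0 0 w 0
    obtain ⟨F, hF, hop, hv, hd⟩ := exists_single hf h1 h2
    refine ⟨F, hv, ?_, ?_⟩
    · rw [hd, h3, h4, Pi.single_zero, sub_zero]
    · rw [hF, hop, lp.inner_single_left, lp.inner_single_left, hf.green (hp e), h1, h2, h3, h4]
      simp only [inner_zero_left, zero_sub, sub_zero]
  -- The sign compensates the minus sign of terminal ends in the node derivative, so both kinds of
  -- end give the same node derivative and the same pairing.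
  · obtain ⟨f, h, hf, h1, h2, h3, h4, -, -⟩ := hext e 0 0 0 (-w)
    obtain ⟨F, hF, hop, hv, hd⟩ := exists_single hf h1 h2
    refine ⟨F, hv, ?_, ?_⟩
    · rw [hd, h3, h4, Pi.single_zero, zero_sub, Pi.single_neg, neg_neg]
    · rw [hF, hop, lp.inner_single_left, lp.inner_single_left, hf.green (hp e), h1, h2, h3, h4]
      simp only [inner_zero_left, inner_neg_left, zero_sub, sub_zero, neg_neg]

/-- The adjoint of the restriction of the maximal operator to functions with vanishing boundary data
is the maximal operator. -/
theorem exists_maxOp_of_weak {g k : N.StateSpace}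
    (H : ∀ F : N.dom, N.nodeVal F = 0 → N.nodeDeriv F = 0 →
      inner ℂ (F : N.StateSpace) k = inner ℂ (N.maxOp F) g) :
    ∃ G : N.dom, (G : N.StateSpace) = g ∧ N.maxOp G = k := by
  classical
  have hp : ∀ e, IsEdgePair e (g e) (k e) := fun e => by
    refine isEdgePair_of_weak e fun f h hf h1 h2 h3 h4 => ?_
    obtain ⟨F, hF, hop, hv, hd⟩ := exists_single hf h1 h2
    have := H F hv (by rw [hd, h3, h4, Pi.single_zero, Pi.single_zero, sub_zero])
    rwa [hF, hop, lp.inner_single_left, lp.inner_single_left] at this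
  -- Test functions at two edge ends of v have equal boundary data, so their difference is in the
  -- kernel of (Γ, Γ'). The hypothesis for it reads ⟨w, z⟩ = ⟨w, z'⟩.
  have huniq : ∀ v z z', IsEndValue g v z → IsEndValue g v z' → z = z' := fun v z z' hz hz' => by
    refine ext_inner_left ℂ fun w => ?_
    obtain ⟨F, h1, h2, h3⟩ := hz.exists_test hp w
    obtain ⟨F', h1', h2', h3'⟩ := hz'.exists_test hp w
    have h4 := H (F - F') (by rw [map_sub, h1, h1', sub_zero]) (by rw [map_sub, h2, h2', sub_self])
    have h5 : N.maxOp (F - F') = N.maxOp F - N.maxOp F' := N.maxOp.map_sub F F'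
    rw [h5, Submodule.coe_sub, inner_sub_left, inner_sub_left] at h4
    linear_combination h3 - h3' - h4
  choose φ hφ using exists_isEndValue g
  have hval : N.IsNodeValues g φ := fun e =>
    ⟨huniq _ _ _ (Or.inl ⟨e, rfl, rfl⟩) (hφ _), huniq _ _ _ (Or.inr ⟨e, rfl, rfl⟩) (hφ _)⟩
  exact ⟨⟨g, memDomain_of_isEdgePair hp hval⟩, rfl, maxOp_eq_of_isEdgePair hp⟩

variable (N)

/-- The functions in the domain with vanishing boundary data. -/
def kerDom : Submodule ℂ N.StateSpace :=
  Submodule.map N.dom.subtype (LinearMap.ker N.nodeVal ⊓ LinearMap.ker N.nodeDeriv)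

variable {N}

theorem mem_kerDom {x : N.StateSpace} :
    x ∈ N.kerDom ↔ ∃ F : N.dom, (F : N.StateSpace) = x ∧ N.nodeVal F = 0 ∧ N.nodeDeriv F = 0 := by
  simp only [kerDom, Submodule.mem_map, Submodule.mem_inf, LinearMap.mem_ker, Submodule.subtype_apply]
  exact ⟨fun ⟨F, h, hx⟩ => ⟨F, hx, h⟩, fun ⟨F, hx, h⟩ => ⟨F, h, hx⟩⟩

/-- A vector k orthogonal to the kernel satisfies the weak equation with g = 0, so k = Π0 = 0. -/
theorem dense_kerDom : Dense (N.kerDom : Set N.StateSpace) := by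
  rw [Submodule.dense_iff_topologicalClosure_eq_top, Submodule.topologicalClosure_eq_top_iff,
    Submodule.eq_bot_iff]
  intro k hk
  obtain ⟨G, hG, hop⟩ := exists_maxOp_of_weak (N := N) (g := 0) (k := k) fun F h1 h2 => by
    rw [inner_zero_right]
    exact (Submodule.mem_orthogonal _ _).1 hk _ (mem_kerDom.2 ⟨F, rfl, h1, h2⟩)
  have h0 : G = 0 := Subtype.ext hG
  rw [← hop, h0]
  exact N.maxOp.map_zero

/-- By Green's identity and `exists_maxOp_of_weak` the graph is cut out by the weak equations, one
closed condition for each test function. -/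
theorem isClosed_maxOp : N.maxOp.IsClosed := by
  have h : (N.maxOp.graph : Set (N.StateSpace × N.StateSpace))
      = ⋂ F : {F : N.dom // N.nodeVal F = 0 ∧ N.nodeDeriv F = 0},
        {x | inner ℂ (F.1 : N.StateSpace) x.2 = inner ℂ (N.maxOp F.1) x.1} := by
    ext ⟨g, k⟩
    simp only [SetLike.mem_coe, LinearPMap.mem_graph_iff, mem_iInter, mem_ofPred_eq]
    constructor
    · rintro ⟨G, rfl, rfl⟩ ⟨F, h1, h2⟩
      have h3 := green_maxOp F G
      have e1 : N.nodeValL2 F = 0 := Subtype.ext h1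
      have e2 : N.nodeDerivL2 F = 0 := Subtype.ext h2
      rw [e1, e2, inner_zero_left, inner_zero_left, sub_zero] at h3
      exact sub_eq_zero.1 h3
    · intro H
      exact exists_maxOp_of_weak fun F h1 h2 => H ⟨F, h1, h2⟩
  rw [LinearPMap.IsClosed, h]
  exact isClosed_iInter fun F => isClosed_eq (continuous_const.inner continuous_snd)
    (continuous_const.inner continuous_fst)

theorem isBoundaryTriple : IsBoundaryTriple N.maxOp N.nodeValL2 N.nodeDerivL2 where
  closed := isClosed_maxOp
  green := green_maxOp
  surjective := fun ⟨φ, ψ⟩ => by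
    obtain ⟨f, h1, h2⟩ := exists_boundary_values φ ψ
    exact ⟨f, Prod.ext h1 h2⟩
  dense_ker := by
    refine dense_kerDom.mono fun x hx => ?_
    obtain ⟨F, h, h1, h2⟩ := mem_kerDom.1 hx
    exact ⟨F, h, Subtype.ext h1, Subtype.ext h2⟩

theorem mem_hamiltonian_domain {x : N.StateSpace} : x ∈ N.hamiltonian.domain ↔
    ∃ F : N.dom, (F : N.StateSpace) = x ∧ ∀ v, N.nodeDeriv F v = (N.eps v : ℂ) • N.nodeVal F v := by
  constructor
  · rintro ⟨⟨F, hF, rfl⟩, -⟩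
    exact ⟨F, rfl, hF⟩
  · rintro ⟨F, rfl, hF⟩
    exact ⟨⟨F, hF, rfl⟩, F.2⟩

theorem hamiltonian_apply (x : N.hamiltonian.domain) (F : N.dom) (h : (F : N.StateSpace) = x) :
    N.hamiltonian x = N.maxOp F :=
  (N.maxOp.domRestrict_le : N.hamiltonian ≤ N.maxOp).2 h.symm

theorem dense_hamiltonian_domain : Dense (N.hamiltonian.domain : Set N.StateSpace) := by
  refine dense_kerDom.mono fun x hx => ?_
  obtain ⟨F, h, h1, h2⟩ := mem_kerDom.1 hx
  exact mem_hamiltonian_domain.2 ⟨F, h, fun v => by rw [h1, h2]; simp⟩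

/-- Under the vertex conditions with real ε the two boundary terms of Green's identity agree node by
node. -/
theorem isFormalAdjoint_hamiltonian : N.hamiltonian.IsFormalAdjoint N.hamiltonian := by
  intro x y
  obtain ⟨F, hF, hFe⟩ := mem_hamiltonian_domain.1 x.2
  obtain ⟨G, hG, hGe⟩ := mem_hamiltonian_domain.1 y.2
  rw [hamiltonian_apply x F hF, hamiltonian_apply y G hG, ← hF, ← hG]
  have h := green_maxOp F G
  have h0 : inner ℂ (N.nodeValL2 F) (N.nodeDerivL2 G)
      = inner ℂ (N.nodeDerivL2 F) (N.nodeValL2 G) := by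
    rw [lp.inner_eq_tsum, lp.inner_eq_tsum]
    refine tsum_congr fun v => ?_
    change inner ℂ (N.nodeVal F v) (N.nodeDeriv G v) = inner ℂ (N.nodeDeriv F v) (N.nodeVal G v)
    rw [hFe, hGe, inner_smul_left, inner_smul_right, Complex.conj_ofReal]
  rw [h0, sub_self] at h
  exact (sub_eq_zero.1 h).symm

/-- Elements of the maximal domain on which the Green form with the domain of the Hamiltonian vanishes
satisfy the vertex conditions. -/
theorem nodeDeriv_eq_of_green {G : N.dom}
    (H : ∀ F : N.dom, (∀ v, N.nodeDeriv F v = (N.eps v : ℂ) • N.nodeVal F v) →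
      inner ℂ (F : N.StateSpace) (N.maxOp G) = inner ℂ (N.maxOp F) (G : N.StateSpace))
    (v : N.vert) : N.nodeDeriv G v = (N.eps v : ℂ) • N.nodeVal G v := by
  classical
  refine ext_inner_left ℂ fun w => ?_
  -- A function in the domain of the Hamiltonian whose boundary data live at v alone, so that the
  -- Green form isolates the condition at v.
  obtain ⟨F, h1, h2⟩ := exists_boundary_values (N := N) (lp.single 2 v w)
    (lp.single 2 v ((N.eps v : ℂ) • w))
  have hFe : ∀ u, N.nodeDeriv F u = (N.eps u : ℂ) • N.nodeVal F u := fun u => by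
    change N.nodeDerivL2 F u = (N.eps u : ℂ) • N.nodeValL2 F u
    rw [h1, h2]
    by_cases hu : u = v
    · subst hu
      rw [lp.single_apply_self, lp.single_apply_self]
    · rw [lp.single_apply_ne _ _ _ hu, lp.single_apply_ne _ _ _ hu, smul_zero]
  have h3 : inner ℂ (N.nodeValL2 F) (N.nodeDerivL2 G)
      = inner ℂ (N.nodeDerivL2 F) (N.nodeValL2 G) :=
    sub_eq_zero.1 ((green_maxOp F G).symm.trans (sub_eq_zero.2 (H F hFe)))
  rw [h1, h2, lp.inner_single_left, lp.inner_single_left, inner_smul_left,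
    Complex.conj_ofReal] at h3
  exact h3.trans (inner_smul_right w (N.nodeVal G v) (N.eps v : ℂ)).symm

/-- The domain of the Hamiltonian contains ker(Γ, Γ'), so elements of the adjoint domain lie in 𝒟
and Π acts on them. The remaining test functions then enforce the vertex conditions. -/
theorem adjoint_hamiltonian_le : N.hamiltonian.adjoint ≤ N.hamiltonian := by
  have hadj := LinearPMap.adjoint_isFormalAdjoint (T := N.hamiltonian) dense_hamiltonian_domain
  have key : ∀ y : N.hamiltonian.adjoint.domain, ∃ G : N.dom, (G : N.StateSpace) = y ∧
      N.maxOp G = N.hamiltonian.adjoint y ∧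
      ∀ v, N.nodeDeriv G v = (N.eps v : ℂ) • N.nodeVal G v := by
    intro y
    have hF : ∀ F : N.dom, (∀ v, N.nodeDeriv F v = (N.eps v : ℂ) • N.nodeVal F v) →
        inner ℂ (F : N.StateSpace) (N.hamiltonian.adjoint y)
          = inner ℂ (N.maxOp F) (y : N.StateSpace) := fun F hFe => by
      have h := hadj.symm ⟨F, mem_hamiltonian_domain.2 ⟨F, rfl, hFe⟩⟩ y
      rw [hamiltonian_apply _ F rfl] at h
      exact h.symm
    obtain ⟨G, hG, hop⟩ := exists_maxOp_of_weak (N := N) (g := y) (k := N.hamiltonian.adjoint y)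
      fun F h1 h2 => hF F fun v => by rw [h1, h2]; simp
    refine ⟨G, hG, hop, nodeDeriv_eq_of_green fun F hFe => ?_⟩
    rw [hop, hG]
    exact hF F hFe
  refine ⟨fun x hx => ?_, fun x y hxy => ?_⟩
  · obtain ⟨G, hG, -, hGe⟩ := key ⟨x, hx⟩
    exact mem_hamiltonian_domain.2 ⟨G, hG, hGe⟩
  · obtain ⟨G, hG, hop, -⟩ := key x
    rw [← hop, hamiltonian_apply y G (hG.trans hxy)]

theorem isSelfAdjoint_hamiltonian : IsSelfAdjoint N.hamiltonian :=
  LinearPMap.isSelfAdjoint_def.2 (le_antisymm adjoint_hamiltonian_le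
    (isFormalAdjoint_hamiltonian.le_adjoint dense_hamiltonian_domain))

end RashbaNetwork

end

theorem mainTheorem5 (N : RashbaNetwork) :
    N.maxOp.IsClosed ∧
    (∀ f : N.dom, Memℓp (N.nodeVal f) 2 ∧ Memℓp (N.nodeDeriv f) 2) ∧
    (∃ Γ Γ' : N.maxOp.domain →ₗ[ℂ] N.NodeSpace,
      (∀ f v, Γ f v = N.nodeVal f v) ∧
      (∀ f v, Γ' f v = N.nodeDeriv f v) ∧
      IsBoundaryTriple N.maxOp Γ Γ') ∧
    IsSelfAdjoint N.hamiltonian :=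
  ⟨RashbaNetwork.isClosed_maxOp, RashbaNetwork.memℓp_node,
    ⟨N.nodeValL2, N.nodeDerivL2, fun _ _ => rfl, fun _ _ => rfl, RashbaNetwork.isBoundaryTriple⟩,
    RashbaNetwork.isSelfAdjoint_hamiltonian⟩
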